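/- Work over an algebraically closed field of characteristic $0$ (for instance $\mathbb{C}$). For integers $d,m_0,n,m\ge 0$ let $\mathcal{L}(d,m_0,n,m)$ be the (quasi-homogeneous) linear system of plane curves of degree $d$ having multiplicity at least $m_0$ at $p_0$ and at least $m$ at each of $p_1,\dots,p_n$, where $p_0,\dots,p_n$ are general points of $\mathbb{P}^2$. Its virtual dimension is $$v=\frac{d(d+3)}2-\frac{m_0(m_0+1)}2-n\,\frac{m(m+1)}2,$$ and its dimension $\ell$ is the minimum, over all choices of $p_0,\dots,p_n\in\mathbb{P}^2$, of the projective dimension of the system (an empty system has dimension $-1$). More generally, a class $(d;m_0,\dots,m_n)$, with all entries integers, stands for $dH-\sum_i m_iE_i$ on the blowup of $\mathbb{P}^2$ at $p_0,\dots,p_n$, where $E_i$ is the exceptional curve over $p_i$. Intersection numbers are $(d;m_i)\cdot(d';m_i')=dd'-\sum_i m_im_i'$, the virtual dimension is $d(d+3)/2-\sum_i m_i(m_i+1)/2$, and the arithmetic genus $g$ is given by $2g-2=d(d-3)-\sum_i m_i(m_i-1)$. A $(-1)$-curve is an irreducible plane curve $A$ (the curves $E_i$ are not counted) whose proper transform on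 this blowup is a smooth rational curve of self-intersection $-1$; equivalently, the class of the proper transform has self-intersection $-1$ and arithmetic genus $0$. A system $\mathcal{L}$ is called $(-1)$-special if there are distinct $(-1)$-curves $A_1,\dots,A_r$ with $\mathcal{L}\cdot A_j=-N_j$, where $N_j\ge1$ for every $j$ and $N_j\ge2$ for some $j$, such that the residual system $\mathcal{M}=\mathcal{L}-\sum_jN_jA_j$ has degree $\ge0$, has virtual dimension $v(\mathcal{M})\ge0$, and has non-negative intersection number with every $(-1)$-curve. Then the $(-1)$-special systems $\mathcal{L}(d,m_0,n,m)$ with $m\le3$ are exactly the systems on the following list, and their virtual dimensions $v$ and dimensions $\ell$ are as listed ($d$ and $e$ are integers): 1. $\mathcal{L}(4,0,5,2)$: $v=-1$, $\ell=0$. 2. $\mathcal{L}(2e,2e-2,2e,2)$, $e\ge1$: $v=-1$, $\ell=0$. 3. $\mathcal{L}(d,d,e,2)$, $d\ge2e\ge2$: $v=d-3e$, $\ell=d-2e$. 4. $\mathcal{L}(4,0,2,3)$: $v=2$, $\ell=3$. 5. $\mathcal{L}(6,0,5,3)$: $v=-3$, $\ell=0$. 6. $\mathcal{L}(6,2,4,3)$: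 $v=0$, $\ell=1$. 7. $\mathcal{L}(3e,3e-3,2e,3)$, $e\ge1$: $v=-3$, $\ell=0$. 8. $\mathcal{L}(3e+1,3e-2,2e,3)$, $e\ge1$: $v=1$, $\ell=2$. 9. $\mathcal{L}(4e,4e-2,2e,3)$, $e\ge1$: $v=-1$, $\ell=0$. 10. $\mathcal{L}(d,d-1,e,3)$, $2d\ge5e\ge5$: $v=2d-6e$, $\ell=2d-5e$. 11. $\mathcal{L}(d,d,e,3)$, $d\ge3e\ge3$: $v=d-6e$, $\ell=d-3e$. -/

import Mathlib

/-- A point of the projective plane over `K`. -/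
abbrev PlanePoint (K : Type*) [Field K] := Projectivization K (Fin 3 → K)

/-- The Taylor expansion of `F` at the vector `v`, i.e. the polynomial `F(v + X)`. -/
noncomputable def taylorAt {K : Type*} [Field K] (v : Fin 3 → K) :
    MvPolynomial (Fin 3) K →ₐ[K] MvPolynomial (Fin 3) K :=
  MvPolynomial.aeval fun i => MvPolynomial.X i + MvPolynomial.C (v i)

/-- `F` has multiplicity at least `m` at the point `p`: all terms of degree less than `m` in the
Taylor expansion of `F` at a representative of `p` vanish. For a homogeneous `F` this does not
depend on the representative, and it is the multiplicity of the plane curve `F = 0` at `p`. -/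
def HasMultGE {K : Type*} [Field K] (F : MvPolynomial (Fin 3) K) (p : PlanePoint K) (m : ℕ) :
    Prop :=
  ∀ s : Fin 3 →₀ ℕ, s.degree < m → (taylorAt p.rep F).coeff s = 0

/-- The vector space of forms of degree `d` with multiplicity at least `m i` at the point `p i`
for each `i`; its projectivization is the linear system of plane curves of degree `d` with
these multiplicities. -/
noncomputable def linearSystem {K : Type*} [Field K] {k : ℕ} (d : ℕ) (m : Fin k → ℕ)
    (p : Fin k → PlanePoint K) : Submodule K (MvPolynomial (Fin 3) K) where
  carrier := {F | F.IsHomogeneous d ∧ ∀ i, HasMultGE F (p i) (m i)}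
  add_mem' := by
    rintro F G ⟨hF, hF'⟩ ⟨hG, hG'⟩
    refine ⟨hF.add hG, fun i s hs => ?_⟩
    rw [map_add, MvPolynomial.coeff_add, hF' i s hs, hG' i s hs, add_zero]
  zero_mem' := ⟨MvPolynomial.isHomogeneous_zero _ _ _, fun i s _ => by simp⟩
  smul_mem' := by
    rintro c F ⟨hF, hF'⟩
    refine ⟨(MvPolynomial.homogeneousSubmodule (Fin 3) K d).smul_mem c hF, fun i s hs => ?_⟩
    rw [map_smul, MvPolynomial.coeff_smul, hF' i s hs, smul_zero]

/-- The dimension (as a projective space, so `-1` for an empty system) of the linear system of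
plane curves of degree `d` with multiplicities `m i` at `k` general points: the minimum over all
choices of the points, which is the value on a nonempty Zariski open set of choices. -/
noncomputable def genericDim (K : Type*) [Field K] {k : ℕ} (d : ℕ) (m : Fin k → ℕ) : ℤ :=
  ((⨅ p : Fin k → PlanePoint K, Module.finrank K (linearSystem d m p) : ℕ) : ℤ) - 1

/-- `P` holds for a general `k`-tuple of points of the plane, i.e. on a nonempty Zariski open
subset of `(ℙ²)ᵏ`: there is a nonzero polynomial `G` in the homogeneous coordinates of the `k`
points such that `P` holds at every tuple having a representative where `G` does not vanish. -/
def ForGeneralPoints (K : Type*) [Field K] (k : ℕ) (P : (Fin k → PlanePoint K) → Prop) : Prop :=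
  ∃ G : MvPolynomial (Fin k × Fin 3) K, G ≠ 0 ∧
    ∀ (v : Fin k → Fin 3 → K) (hv : ∀ i, v i ≠ 0),
      MvPolynomial.eval (fun ij => v ij.1 ij.2) G ≠ 0 →
        P fun i => Projectivization.mk K (v i) (hv i)

/-- Divisor classes on the blowup of the plane at `k` general points; the pair `(d, m)` stands
for the class `d H - ∑ i, m i E i`. -/
abbrev BlowupClass (k : ℕ) := ℤ × (Fin k → ℤ)

namespace BlowupClass

/-- The intersection number of two classes. -/
def inter {k : ℕ} (A B : BlowupClass k) : ℤ := A.1 * B.1 - ∑ i, A.2 i * B.2 i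

/-- The virtual dimension `d (d + 3) / 2 - ∑ i, m i (m i + 1) / 2`. All divisions are exact. -/
def vdim {k : ℕ} (A : BlowupClass k) : ℤ :=
  A.1 * (A.1 + 3) / 2 - ∑ i, A.2 i * (A.2 i + 1) / 2

/-- The arithmetic genus `g`, given by `2 g - 2 = d (d - 3) - ∑ i, m i (m i - 1)`.
All divisions are exact. -/
def genus {k : ℕ} (A : BlowupClass k) : ℤ :=
  (A.1 - 1) * (A.1 - 2) / 2 - ∑ i, A.2 i * (A.2 i - 1) / 2

/-- `A` is the class of a `(-1)`-curve: for general points there is an irreducible plane curve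
whose proper transform on the blowup has class `A`, with self-intersection `-1` and arithmetic
genus `0`. (An irreducible curve has arithmetic genus `0` exactly if it is smooth and rational.)
The exceptional curves over the points are not plane curves and are not counted. -/
def IsMinusOneCurve (K : Type*) [Field K] {k : ℕ} (A : BlowupClass k) : Prop :=
  A.inter A = -1 ∧ A.genus = 0 ∧
    ∃ (δ : ℕ) (μ : Fin k → ℕ), A = ((δ : ℤ), fun i => (μ i : ℤ)) ∧
      ForGeneralPoints K k fun p =>
        ∃ F ∈ linearSystem (K := K) δ μ p, Irreducible F ∧ ∀ i, ¬ HasMultGE F (p i) (μ i + 1)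

/-- The residual class `L - ∑ A ∈ S, N A • A`, where `N A = - L·A`. -/
def residual {k : ℕ} (L : BlowupClass k) (S : Finset (BlowupClass k)) : BlowupClass k :=
  L - ∑ A ∈ S, (-(L.inter A)) • A

/-- The system `L` is `(-1)`-special: there are (distinct) `(-1)`-curves `A`, forming the finite
set `S`, with `L·A = - N A`, all `N A ≥ 1` and some `N A ≥ 2`, such that the residual system
`M = L - ∑ N A • A` is a system of plane curves (of degree `≥ 0`) with virtual dimension `≥ 0`
and has nonnegative intersection with every `(-1)`-curve. -/
def IsMinusOneSpecial (K : Type*) [Field K] {k : ℕ} (L : BlowupClass k) : Prop :=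
  ∃ S : Finset (BlowupClass k),
    (∀ A ∈ S, A.IsMinusOneCurve K ∧ 1 ≤ -(L.inter A)) ∧
    (∃ A ∈ S, 2 ≤ -(L.inter A)) ∧
    0 ≤ (L.residual S).1 ∧
    0 ≤ (L.residual S).vdim ∧
    ∀ A : BlowupClass k, A.IsMinusOneCurve K → 0 ≤ (L.residual S).inter A

end BlowupClass

/-- The multiplicities `(m₀, m, …, m)` at the points `p₀, p₁, …, pₙ`. -/
def quasiHomMult (m₀ n m : ℕ) : Fin (n + 1) → ℕ := Fin.cons m₀ fun _ => m

/-- The class of the quasi-homogeneous system `ℒ(d, m₀, n, m)`. -/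
def quasiHomClass (d m₀ n m : ℕ) : BlowupClass (n + 1) :=
  ((d : ℤ), fun i => (quasiHomMult m₀ n m i : ℤ))

/-- `ListedSystem d m₀ n m v l`: the system `ℒ(d, m₀, n, m)` is on the list, with entries `v` and
`l` in the columns of virtual and actual dimensions. The natural number subtractions
are never truncated. -/
inductive ListedSystem : ℕ → ℕ → ℕ → ℕ → ℤ → ℤ → Prop
  | row1 : ListedSystem 4 0 5 2 (-1) 0
  | row2 (e : ℕ) (he : 1 ≤ e) : ListedSystem (2 * e) (2 * e - 2) (2 * e) 2 (-1) 0
  | row3 (d e : ℕ) (hd : 2 * e ≤ d) (he : 2 ≤ 2 * e) :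
      ListedSystem d d e 2 (d - 3 * e) (d - 2 * e)
  | row4 : ListedSystem 4 0 2 3 2 3
  | row5 : ListedSystem 6 0 5 3 (-3) 0
  | row6 : ListedSystem 6 2 4 3 0 1
  | row7 (e : ℕ) (he : 1 ≤ e) : ListedSystem (3 * e) (3 * e - 3) (2 * e) 3 (-3) 0
  | row8 (e : ℕ) (he : 1 ≤ e) : ListedSystem (3 * e + 1) (3 * e - 2) (2 * e) 3 1 2
  | row9 (e : ℕ) (he : 1 ≤ e) : ListedSystem (4 * e) (4 * e - 2) (2 * e) 3 (-1) 0
  | row10 (d e : ℕ) (hd : 5 * e ≤ 2 * d) (he : 5 ≤ 5 * e) :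
      ListedSystem d (d - 1) e 3 (2 * d - 6 * e) (2 * d - 5 * e)
  | row11 (d e : ℕ) (hd : 3 * e ≤ d) (he : 3 ≤ 3 * e) :
      ListedSystem d d e 3 (d - 6 * e) (d - 3 * e)

/-! Only three families of (-1)-curves matter: the lines through p₀ and one pᵢ, the monoidal curves
(f+1; f, 1ⁿ) with n = 2(f+1), and, for n = 5, the conic through p₁, ..., p₅.

The basic tool is Bézout's inequality with multiplicities (`sum_mult_mul_le`), obtained by counting
dimensions of linear systems. It has two consequences. Distinct (-1)-curves meet non-negatively, and
a curve A with L·A < 0 divides every member of L.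

Listed systems are special: each is written L = M + ∑ N_A A with pairwise disjoint curves A from the
three families, all disjoint from M. Then L·A = -N_A. Here M is either a multiple of the pencil of
lines through p₀ (possibly 0) or a (-1)-curve class with some simple points forgotten. Such an M
meets all (-1)-curves non-negatively and has the expected dimension. For general points the curves A
split off from L, so ℓ(L) = v(M) (`genericDim_eq`).

Special systems are listed: let M be the residual of L for a set S of curves. Every (-1)-curve that
is negative on L lies in S, and M·A = 0 for A in S. The multiplicities of M are non-negative
(`residual_snd_nonneg`): otherwise a curve of S through pᵢ would be a component of a fixed curve D
that imposes nothing at pᵢ, and moving pᵢ off D is a contradiction. Hence ∑ N_A mult_{pᵢ}(A) ≤ m ≤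
3. If N_A ≥ 2, then A is at most simple at each pᵢ, i ≥ 1. The class L is invariant under permuting
p₁, ..., pₙ, so the permuted images of A also lie in S with the same N_A, and those different from A
share no pᵢ with A because 2 + 2 > 3. The equations A² = -1 and g(A) = 0 then leave the three
families (`isSimpleType_of_mem`). For each family, the bounds on N_A, the intersection with the
lines and the condition v(M) ≥ 0 determine d, m₀ and n. -/

open MvPolynomial

/-! ### Order of vanishing of polynomials and homogeneous factors. -/

/-- The smallest degree of a term of `P`. -/
noncomputable def lowOrder {σ K : Type*} [Field K] (P : MvPolynomial σ K) : ℕ∞ :=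
  (P : MvPowerSeries σ K).order

theorem le_lowOrder_iff {σ K : Type*} [Field K] {P : MvPolynomial σ K} {m : ℕ} :
    (m : ℕ∞) ≤ lowOrder P ↔ ∀ s : σ →₀ ℕ, s.degree < m → P.coeff s = 0 := by
  constructor
  · intro h s hs
    rw [← coeff_coe]
    exact MvPowerSeries.coeff_of_lt_order (lt_of_lt_of_le (by exact_mod_cast hs) h)
  · intro h
    exact MvPowerSeries.nat_le_order fun s hs => by rw [coeff_coe]; exact h s hs

theorem lowOrder_mul {σ K : Type*} [Field K] (P Q : MvPolynomial σ K) :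
    lowOrder (P * Q) = lowOrder P + lowOrder Q := by
  simp [lowOrder, MvPowerSeries.order_mul]

theorem lowOrder_eq_top_iff {σ K : Type*} [Field K] {P : MvPolynomial σ K} :
    lowOrder P = ⊤ ↔ P = 0 := by
  simp [lowOrder]

theorem lowOrder_le_totalDegree {σ K : Type*} [Field K] {P : MvPolynomial σ K} (h : P ≠ 0) :
    lowOrder P ≤ P.totalDegree := by
  by_contra! hlt
  obtain ⟨s, hs⟩ := ne_zero_iff.1 h
  have h1 : ((P.totalDegree + 1 : ℕ) : ℕ∞) ≤ lowOrder P := by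
    simpa using Order.add_one_le_of_lt hlt
  refine hs (le_lowOrder_iff.1 h1 s (Nat.lt_succ_of_le ?_))
  exact le_totalDegree (mem_support_iff.2 hs)

theorem isHomogeneous_iff_lowOrder {σ K : Type*} [Field K] {P : MvPolynomial σ K}
    {d : ℕ} : P.IsHomogeneous d ↔ (d : ℕ∞) ≤ lowOrder P ∧ P.totalDegree ≤ d := by
  constructor
  · intro hP
    exact ⟨le_lowOrder_iff.2 fun s hs => hP.coeff_eq_zero hs.ne, hP.totalDegree_le⟩
  · rintro ⟨h1, h2⟩ s hs
    have h3 : s.degree ≤ d := (le_totalDegree (mem_support_iff.2 hs)).trans h2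
    have h4 : ¬ s.degree < d := fun hlt => hs (le_lowOrder_iff.1 h1 s hlt)
    have : s.degree = d := by omega
    rw [← this, Finsupp.degree_eq_weight_one]; rfl

/-- Order and total degree are both additive on products, and order ≤ degree for each factor.
Equality for the product therefore forces equality for both factors. -/
theorem isHomogeneous_of_mul {σ K : Type*} [Field K] {P Q : MvPolynomial σ K} {d : ℕ}
    (h : (P * Q).IsHomogeneous d) (hP : P ≠ 0) (hQ : Q ≠ 0) :
    ∃ a b, a + b = d ∧ P.IsHomogeneous a ∧ Q.IsHomogeneous b := by
  have h0 := (isHomogeneous_iff_lowOrder).1 h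
  have hd := h.totalDegree (mul_ne_zero hP hQ)
  rw [totalDegree_mul_of_isDomain hP hQ] at hd
  rw [lowOrder_mul] at h0
  have hP' := lowOrder_le_totalDegree hP
  have hQ' := lowOrder_le_totalDegree hQ
  obtain ⟨x, hx⟩ := ENat.ne_top_iff_exists.1 (mt lowOrder_eq_top_iff.1 hP)
  obtain ⟨y, hy⟩ := ENat.ne_top_iff_exists.1 (mt lowOrder_eq_top_iff.1 hQ)
  rw [← hx, ← hy] at h0
  rw [← hx] at hP'
  rw [← hy] at hQ'
  have h1 : d ≤ x + y := by exact_mod_cast h0.1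
  have h2 : x ≤ P.totalDegree := by exact_mod_cast hP'
  have h3 : y ≤ Q.totalDegree := by exact_mod_cast hQ'
  refine ⟨_, _, hd, (isHomogeneous_iff_lowOrder).2 ⟨?_, le_rfl⟩,
    (isHomogeneous_iff_lowOrder).2 ⟨?_, le_rfl⟩⟩
  · rw [← hx]; exact_mod_cast (by omega : P.totalDegree ≤ x)
  · rw [← hy]; exact_mod_cast (by omega : Q.totalDegree ≤ y)

/-! ### Multiplicity of a form at a point. -/

section Mult

variable {K : Type*} [Field K]

theorem taylorAt_X (v : Fin 3 → K) (i : Fin 3) : taylorAt v (X i) = X i + C (v i) := by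
  simp [taylorAt]

theorem taylorAt_injective (v : Fin 3 → K) : Function.Injective (taylorAt v) := by
  have h : (taylorAt (-v)).comp (taylorAt v) = AlgHom.id K _ := by
    ext1 i
    simp [taylorAt]
  exact Function.LeftInverse.injective (g := taylorAt (-v)) fun F => DFunLike.congr_fun h F

theorem coeff_zero_taylorAt (v : Fin 3 → K) (F : MvPolynomial (Fin 3) K) :
    (taylorAt v F).coeff 0 = eval v F := by
  have h : (constantCoeff : MvPolynomial (Fin 3) K →+* K).comp
      (taylorAt v : MvPolynomial (Fin 3) K →+* MvPolynomial (Fin 3) K) = eval v := by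
    ext i
    · simp
    · simp [taylorAt]
  exact DFunLike.congr_fun h F

/-- The order of vanishing of `F` at the vector `v`. -/
noncomputable def multAt (v : Fin 3 → K) (F : MvPolynomial (Fin 3) K) : ℕ∞ :=
  lowOrder (taylorAt v F)

theorem multAt_mul (v : Fin 3 → K) (F G : MvPolynomial (Fin 3) K) :
    multAt v (F * G) = multAt v F + multAt v G := by
  rw [multAt, map_mul, lowOrder_mul]; rfl

theorem hasMultGE_iff {F : MvPolynomial (Fin 3) K} {p : PlanePoint K} {m : ℕ} :
    HasMultGE F p m ↔ (m : ℕ∞) ≤ multAt p.rep F :=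
  le_lowOrder_iff.symm

theorem HasMultGE.mono {F : MvPolynomial (Fin 3) K} {p : PlanePoint K} {m n : ℕ}
    (h : HasMultGE F p n) (hmn : m ≤ n) : HasMultGE F p m :=
  fun s hs => h s (hs.trans_le hmn)

theorem hasMultGE_zero (F : MvPolynomial (Fin 3) K) (p : PlanePoint K) : HasMultGE F p 0 :=
  fun _ hs => absurd hs (Nat.not_lt_zero _)

theorem HasMultGE.zero (p : PlanePoint K) (m : ℕ) :
    HasMultGE (0 : MvPolynomial (Fin 3) K) p m :=
  fun s _ => by simp

theorem HasMultGE.add {F G : MvPolynomial (Fin 3) K} {p : PlanePoint K} {m : ℕ}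
    (hF : HasMultGE F p m) (hG : HasMultGE G p m) : HasMultGE (F + G) p m :=
  fun s hs => by rw [map_add, coeff_add, hF s hs, hG s hs, add_zero]

theorem HasMultGE.mul {F G : MvPolynomial (Fin 3) K} {p : PlanePoint K} {m n : ℕ}
    (hF : HasMultGE F p m) (hG : HasMultGE G p n) : HasMultGE (F * G) p (m + n) := by
  rw [hasMultGE_iff] at *
  rw [multAt_mul]
  push_cast
  exact add_le_add hF hG

theorem HasMultGE.of_mul {F G : MvPolynomial (Fin 3) K} {p : PlanePoint K} {m n : ℕ}
    (h : HasMultGE (F * G) p (m + n)) (hF : ¬ HasMultGE F p (m + 1)) : HasMultGE G p n := by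
  rw [hasMultGE_iff] at *
  rw [multAt_mul] at h
  rcases eq_or_ne (multAt p.rep F) ⊤ with h1 | h1
  · rw [h1] at hF; exact absurd le_top hF
  rcases eq_or_ne (multAt p.rep G) ⊤ with h2 | h2
  · rw [h2]; exact le_top
  obtain ⟨x, hx⟩ := ENat.ne_top_iff_exists.1 h1
  obtain ⟨y, hy⟩ := ENat.ne_top_iff_exists.1 h2
  rw [← hx, ← hy] at h
  rw [← hx] at hF
  rw [← hy]
  norm_cast at *
  omega

theorem hasMultGE_mul_dichotomy {F G : MvPolynomial (Fin 3) K} {p : PlanePoint K} {m n : ℕ}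
    (h : HasMultGE (F * G) p (m + n + 1)) : HasMultGE F p (m + 1) ∨ HasMultGE G p (n + 1) := by
  by_cases hF : HasMultGE F p (m + 1)
  · exact Or.inl hF
  · exact Or.inr (HasMultGE.of_mul (m := m) (n := n + 1) (by rwa [add_assoc] at h) hF)

theorem coeff_aeval_C_mul_X (c : K) (P : MvPolynomial (Fin 3) K) (s : Fin 3 →₀ ℕ) :
    (aeval (fun i => C c * X i : Fin 3 → MvPolynomial (Fin 3) K) P).coeff s
      = c ^ s.degree * P.coeff s := by
  induction P using MvPolynomial.induction_on' with
  | monomial u a =>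
    rw [aeval_monomial]
    have : (u.prod fun i k => (C c * X i : MvPolynomial (Fin 3) K) ^ k)
        = monomial u (c ^ u.degree) := by
      simp only [mul_pow, Finsupp.prod_mul]
      rw [monomial_eq]
      congr 1
      rw [Finsupp.prod, Finset.prod_pow_eq_pow_sum, Finsupp.degree_apply, map_pow]
    rw [this, algebraMap_eq, C_mul_monomial, coeff_monomial, coeff_monomial]
    split_ifs with h
    · subst h; ring
    · simp
  | add p q hp hq => rw [map_add, coeff_add, coeff_add, hp, hq, mul_add]

theorem aeval_smul_homogeneous {A : Type*} [CommRing A] [Algebra K A] {F : MvPolynomial (Fin 3) K}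
    {d : ℕ} (hF : F.IsHomogeneous d) (c : A) (f : Fin 3 → A) :
    aeval (fun i => c * f i) F = c ^ d * aeval f F := by
  rw [F.as_sum, map_sum, map_sum, Finset.mul_sum]
  refine Finset.sum_congr rfl fun s hs => ?_
  rw [aeval_monomial, aeval_monomial]
  simp only [mul_pow, Finsupp.prod_mul]
  have : (s.prod fun _ k => c ^ k) = c ^ d := by
    rw [Finsupp.prod, Finset.prod_pow_eq_pow_sum]
    congr 1
    by_contra hne
    exact mem_support_iff.1 hs (hF.coeff_eq_zero hne)
  rw [this]; ring

/-- Since F(cv + cX) = c^d F(v + X), corresponding Taylor coefficients differ by nonzero factors.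
This makes multiplicity independent of the representative vector. -/
theorem multAt_smul {F : MvPolynomial (Fin 3) K} {d : ℕ} (hF : F.IsHomogeneous d) {c : K}
    (hc : c ≠ 0) (v : Fin 3 → K) : multAt (c • v) F = multAt v F := by
  have key : aeval (fun i => C c * X i : Fin 3 → MvPolynomial (Fin 3) K) (taylorAt (c • v) F)
      = C c ^ d * taylorAt v F := by
    rw [taylorAt, taylorAt, ← aeval_smul_homogeneous hF, ← AlgHom.comp_apply, comp_aeval]
    congr 2
    funext i
    simp [mul_add]
  have hcoeff : ∀ s, c ^ s.degree * (taylorAt (c • v) F).coeff s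
      = c ^ d * (taylorAt v F).coeff s := by
    intro s
    rw [← coeff_aeval_C_mul_X, key, ← map_pow, coeff_C_mul]
  have hz : ∀ s, (taylorAt (c • v) F).coeff s = 0 ↔ (taylorAt v F).coeff s = 0 := by
    intro s
    have h1 := hcoeff s
    constructor
    · intro h
      rw [h, mul_zero] at h1
      exact (mul_eq_zero.1 h1.symm).resolve_left (pow_ne_zero _ hc)
    · intro h
      rw [h, mul_zero] at h1
      exact (mul_eq_zero.1 h1).resolve_left (pow_ne_zero _ hc)
  refine ENat.eq_of_forall_natCast_le_iff fun m => ?_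
  simp only [multAt, le_lowOrder_iff, hz]

theorem multAt_mk_rep {F : MvPolynomial (Fin 3) K} {d : ℕ} (hF : F.IsHomogeneous d)
    (v : Fin 3 → K) (hv : v ≠ 0) : multAt (Projectivization.mk K v hv).rep F = multAt v F := by
  obtain ⟨a, ha⟩ := Projectivization.exists_smul_eq_mk_rep K v hv
  rw [← ha]
  exact multAt_smul hF a.ne_zero v

theorem totalDegree_taylorAt_le (v : Fin 3 → K) (F : MvPolynomial (Fin 3) K) :
    (taylorAt v F).totalDegree ≤ F.totalDegree := by
  conv_lhs => rw [F.as_sum, map_sum]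
  refine totalDegree_finsetSum_le fun s hs => ?_
  rw [taylorAt, aeval_monomial, algebraMap_eq]
  refine (totalDegree_mul _ _).trans ?_
  rw [totalDegree_C, zero_add, Finsupp.prod]
  refine (totalDegree_finsetProd _ _).trans ?_
  refine le_trans (Finset.sum_le_sum fun i _ => ?_) (le_totalDegree hs)
  refine (totalDegree_pow _ _).trans ?_
  have h1 : (X i + C (v i) : MvPolynomial (Fin 3) K).totalDegree ≤ 1 :=
    (totalDegree_add _ _).trans (by simp)
  simpa using Nat.mul_le_mul_left (s i) h1

/-- Translation is injective and does not raise the degree, while the order of a nonzero polynomial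
is at most its degree. -/
theorem eq_zero_of_degree_lt_mult {F : MvPolynomial (Fin 3) K} {d m : ℕ} (hF : F.IsHomogeneous d)
    {p : PlanePoint K} (h : HasMultGE F p m) (hm : d < m) : F = 0 := by
  by_contra hne
  have h1 : taylorAt p.rep F ≠ 0 := fun h0 => hne (taylorAt_injective p.rep (by rw [h0, map_zero]))
  have h2 := lowOrder_le_totalDegree h1
  have h3 := hasMultGE_iff.1 h
  have h4 := (totalDegree_taylorAt_le p.rep F).trans hF.totalDegree_le
  have h5 : (m : ℕ∞) ≤ ((taylorAt p.rep F).totalDegree : ℕ∞) := h3.trans h2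
  norm_cast at h5
  omega

theorem hasMultGE_one_iff {F : MvPolynomial (Fin 3) K} {p : PlanePoint K} :
    HasMultGE F p 1 ↔ eval p.rep F = 0 := by
  rw [← coeff_zero_taylorAt]
  constructor
  · intro h; exact h 0 (by simp)
  · intro h s hs
    have : s = 0 := by rw [← Finsupp.degree_eq_zero_iff]; omega
    rw [this, h]

theorem hasMultGE_mk_iff {F : MvPolynomial (Fin 3) K} {d : ℕ} (hF : F.IsHomogeneous d)
    {v : Fin 3 → K} (hv : v ≠ 0) {m : ℕ} :
    HasMultGE F (Projectivization.mk K v hv) m ↔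
      ∀ s : Fin 3 →₀ ℕ, s.degree < m → (taylorAt v F).coeff s = 0 := by
  rw [hasMultGE_iff, multAt_mk_rep hF v hv, multAt, le_lowOrder_iff]

theorem pderiv_taylorAt (v : Fin 3 → K) (F : MvPolynomial (Fin 3) K) (i : Fin 3) :
    pderiv i (taylorAt v F) = taylorAt v (pderiv i F) := by
  induction F using MvPolynomial.induction_on with
  | C a => simp
  | add p q hp hq => simp [hp, hq]
  | mul_X p j hp =>
    rw [map_mul, Derivation.leibniz, hp, Derivation.leibniz, map_add]
    simp only [smul_eq_mul, map_mul, taylorAt_X, map_add, pderiv_C, add_zero, pderiv_X]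
    congr 2
    by_cases h : i = j
    · subst h; simp
    · simp [h]

/-- The coefficients of the Taylor expansion of a form not involving the `j`-th variable determine
the other ones. -/
theorem coeff_taylorAt_eq_zero [CharZero K] {F : MvPolynomial (Fin 3) K} {d m : ℕ}
    (hF : F.IsHomogeneous d) {v : Fin 3 → K} {j : Fin 3} (hj : v j ≠ 0)
    (h : ∀ s : Fin 3 →₀ ℕ, s j = 0 → s.degree < m → (taylorAt v F).coeff s = 0) :
    ∀ s : Fin 3 →₀ ℕ, s.degree < m → (taylorAt v F).coeff s = 0 := by
  have euler := congrArg (taylorAt v) hF.sum_X_mul_pderiv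
  simp only [map_sum, map_mul, taylorAt_X, ← pderiv_taylorAt, map_nsmul, add_mul,
    Finset.sum_add_distrib] at euler
  -- Let T be the Taylor expansion at v. Compare coefficients of X^s in the translated Euler
  -- identity ∑ (Xᵢ + vᵢ) ∂ᵢT = d T: the terms Xᵢ ∂ᵢT and d T contribute only multiples of the
  -- coefficient of T at s, which vanishes.
  have hco : ∀ s : Fin 3 →₀ ℕ, (taylorAt v F).coeff s = 0 →
      ∑ i, v i * ((taylorAt v F).coeff (s + Finsupp.single i 1) * (s i + 1)) = 0 := by
    intro s hs
    have h1 := congrArg (coeff s) euler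
    have h2 : ∀ i, (X i * pderiv i (taylorAt v F)).coeff s = s i * (taylorAt v F).coeff s := by
      intro i
      rw [coeff_X_mul']
      split_ifs with hi
      · rw [coeff_pderiv, tsub_add_cancel_of_le, mul_comm]
        · congr 1
          rw [Finsupp.mem_support_iff] at hi
          rw [Finsupp.tsub_apply, Finsupp.single_eq_same]
          exact_mod_cast Nat.sub_add_cancel (Nat.one_le_iff_ne_zero.2 hi)
        · simpa [Finsupp.single_le_iff, Nat.one_le_iff_ne_zero] using hi
      · rw [Finsupp.notMem_support_iff.1 hi]; simp
    simp only [coeff_add, coeff_sum, h2, hs, mul_zero, Finset.sum_const_zero, zero_add, coeff_smul,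
      smul_zero, coeff_C_mul, coeff_pderiv] at h1
    exact h1
  suffices H : ∀ k, ∀ s : Fin 3 →₀ ℕ, s j = k → s.degree < m → (taylorAt v F).coeff s = 0 from
    fun s => H _ s rfl
  intro k
  induction k with
  | zero => exact h
  | succ k ih =>
    intro s hs hd
    obtain ⟨u, rfl⟩ : ∃ u, s = u + Finsupp.single j 1 := by
      refine ⟨s - Finsupp.single j 1, ?_⟩
      rw [tsub_add_cancel_of_le]
      simp [Finsupp.single_le_iff, hs]
    have hu : u j = k := by simpa using hs
    have hdeg : ∀ i, (u + Finsupp.single i 1).degree = u.degree + 1 := by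
      intro i; simp
    rw [hdeg] at hd
    have h0 := hco u (ih u hu (by omega))
    -- Terms with i ≠ j have j-th exponent k and vanish by induction. In the remaining one, vⱼ(uⱼ +
    -- 1) ≠ 0 by characteristic zero.
    rw [Finset.sum_eq_single j] at h0
    · have : (u j + 1 : K) ≠ 0 := by exact_mod_cast Nat.succ_ne_zero (u j)
      simpa [hj, this] using h0
    · intro i _ hij
      rw [ih (u + Finsupp.single i 1) (by simp [hu, hij]) (by rw [hdeg]; omega)]
      simp
    · simp

end Mult

/-! ### Dimension counts for linear systems and Bézout's inequality. -/

section Forms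

variable (K : Type*) [Field K]

theorem finrank_forms (d : ℕ) :
    Module.finrank K (homogeneousSubmodule (Fin 3) K d) = (d + 2).choose 2 := by
  rw [homogeneousSubmodule_eq_finsupp_supported,
    (AddMonoidAlgebra.supportedEquivFinsupp (R := K) (S := K) _).finrank_eq]
  have hset : {s : Fin 3 →₀ ℕ | s.degree = d} = ((Finset.univ : Finset (Fin 3)).finsuppAntidiag d :
      Set (Fin 3 →₀ ℕ)) := by
    ext s
    simp [Finset.mem_finsuppAntidiag, Finsupp.degree_eq_sum]
  rw [hset, Module.finrank_finsupp_self]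
  simp only [Finset.coe_sort_coe, Fintype.card_coe]
  rw [Finset.card_finsuppAntidiag_nat_eq_choose, Finset.card_fin, show 3 + d - 1 = d + 2 by omega,
    ← Nat.choose_symm (by omega : 2 ≤ d + 2)]
  rfl

instance finiteDimensional_forms (d : ℕ) :
    FiniteDimensional K (homogeneousSubmodule (Fin 3) K d) :=
  Module.Finite.iff_fg.2 (homogeneousSubmodule_fg (Fin 3) K d)

variable {K}

theorem linearSystem_le {k : ℕ} (d : ℕ) (m : Fin k → ℕ) (p : Fin k → PlanePoint K) :
    linearSystem d m p ≤ homogeneousSubmodule (Fin 3) K d := fun _ h => h.1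

instance finiteDimensional_linearSystem {k : ℕ} (d : ℕ) (m : Fin k → ℕ)
    (p : Fin k → PlanePoint K) : FiniteDimensional K (linearSystem d m p) :=
  Submodule.finiteDimensional_of_le (linearSystem_le d m p)

theorem mul_mem_linearSystem {k : ℕ} {d e : ℕ} {m n : Fin k → ℕ} {p : Fin k → PlanePoint K}
    {F G : MvPolynomial (Fin 3) K} (hF : F ∈ linearSystem d m p) (hG : G ∈ linearSystem e n p) :
    F * G ∈ linearSystem (d + e) (m + n) p :=
  ⟨hF.1.mul hG.1, fun i => (hF.2 i).mul (hG.2 i)⟩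

theorem linearSystem_mono {k : ℕ} {d : ℕ} {m n : Fin k → ℕ} (h : m ≤ n)
    (p : Fin k → PlanePoint K) : linearSystem d n p ≤ linearSystem d m p :=
  fun _ hF => ⟨hF.1, fun i => (hF.2 i).mono (h i)⟩

/-- Exponents of degree less than `m` not involving the `j`-th variable. -/
def jetExponents (m : ℕ) (j : Fin 3) : Finset (Fin 3 →₀ ℕ) :=
  (Finset.range m).biUnion fun t => (Finset.univ.erase j).finsuppAntidiag t

theorem card_jetExponents_le (m : ℕ) (j : Fin 3) :
    (jetExponents m j).card ≤ (m + 1).choose 2 := by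
  refine Finset.card_biUnion_le.trans ?_
  have : ∀ t, ((Finset.univ.erase j : Finset (Fin 3)).finsuppAntidiag t).card = t + 1 := by
    intro t
    rw [Finset.card_finsuppAntidiag_nat_eq_choose, Finset.card_erase_of_mem (Finset.mem_univ j),
      Finset.card_fin, show 3 - 1 + t - 1 = t + 1 by omega, Nat.choose_succ_self_right]
  rw [Finset.sum_congr rfl fun t _ => this t, Nat.choose_two_right, Nat.add_sub_cancel]
  have := Finset.sum_range_id_mul_two (m + 1)
  rw [Finset.sum_range_succ'] at this
  simp only [add_zero, Nat.add_sub_cancel] at this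
  omega

theorem mem_jetExponents {m : ℕ} {j : Fin 3} {s : Fin 3 →₀ ℕ} (h0 : s j = 0)
    (h : s.degree < m) : s ∈ jetExponents m j := by
  rw [jetExponents, Finset.mem_biUnion]
  refine ⟨s.degree, Finset.mem_range.2 h, ?_⟩
  rw [Finset.mem_finsuppAntidiag']
  refine ⟨rfl, fun i hi => ?_⟩
  rw [Finset.mem_erase]
  refine ⟨?_, Finset.mem_univ _⟩
  rintro rfl
  exact Finsupp.mem_support_iff.1 hi h0

/-- A point of multiplicity `m` imposes at most `m (m + 1) / 2` conditions. -/
theorem finrank_forms_le [CharZero K] {k : ℕ} (d : ℕ) (m : Fin k → ℕ)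
    (p : Fin k → PlanePoint K) :
    (d + 2).choose 2 ≤
      Module.finrank K (linearSystem d m p) + ∑ i, (m i + 1).choose 2 := by
  have hj : ∀ i, ∃ j, (p i).rep j ≠ 0 := fun i => Function.ne_iff.1 (p i).rep_nonzero
  choose j hj using hj
  let J : Type := Σ i, jetExponents (m i) (j i)
  let f : homogeneousSubmodule (Fin 3) K d →ₗ[K] (J → K) :=
    LinearMap.pi fun x => (lcoeff K (x.2 : Fin 3 →₀ ℕ)) ∘ₗ (taylorAt (p x.1).rep).toLinearMap ∘ₗ
      (homogeneousSubmodule (Fin 3) K d).subtype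
  have hker : ∀ F ∈ LinearMap.ker f, (F : MvPolynomial (Fin 3) K) ∈ linearSystem d m p := by
    intro F hF
    refine ⟨F.2, fun i => coeff_taylorAt_eq_zero F.2 (hj i) fun s hs hd => ?_⟩
    exact congrFun (LinearMap.mem_ker.1 hF) ⟨i, s, mem_jetExponents hs hd⟩
  have h1 := f.finrank_range_add_finrank_ker
  have h2 : Module.finrank K (LinearMap.range f) ≤ ∑ i, (m i + 1).choose 2 := by
    refine (Submodule.finrank_le _).trans ?_
    rw [Module.finrank_fintype_fun_eq_card, Fintype.card_sigma]
    refine Finset.sum_le_sum fun i _ => ?_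
    rw [Fintype.card_coe]
    exact card_jetExponents_le _ _
  have h3 : Module.finrank K (LinearMap.ker f) ≤ Module.finrank K (linearSystem d m p) := by
    let g : LinearMap.ker f →ₗ[K] linearSystem d m p :=
      LinearMap.codRestrict _ ((homogeneousSubmodule (Fin 3) K d).subtype ∘ₗ
        (LinearMap.ker f).subtype) fun x => hker x.1 x.2
    refine LinearMap.finrank_le_finrank_of_injective (f := g) fun x y hxy => ?_
    have h : (x.1 : MvPolynomial (Fin 3) K) = y.1 := congrArg (fun z : linearSystem d m p => (z : MvPolynomial (Fin 3) K)) hxy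
    exact Subtype.ext (Subtype.ext h)
  rw [finrank_forms] at h1
  omega

theorem exists_linear_form {p q : PlanePoint K} (h : p ≠ q) :
    ∃ F : MvPolynomial (Fin 3) K, F.IsHomogeneous 1 ∧ HasMultGE F p 1 ∧ ¬ HasMultGE F q 1 := by
  have hq : q.rep ∉ Submodule.span K {p.rep} := by
    intro hmem
    obtain ⟨a, ha⟩ := Submodule.mem_span_singleton.1 hmem
    refine h ?_
    rw [← p.mk_rep, ← q.mk_rep]
    exact ((Projectivization.mk_eq_mk_iff' K _ _ q.rep_nonzero p.rep_nonzero).2 ⟨a, ha⟩).symm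
  obtain ⟨f, hfq, hfp⟩ := Submodule.exists_le_ker_of_notMem hq
  have hev : ∀ v, eval v (∑ i, C (f (Pi.single i 1)) * X i) = f v := by
    intro v
    simp only [map_sum, map_mul, eval_C, eval_X]
    conv_rhs => rw [pi_eq_sum_univ' v, map_sum]
    refine Finset.sum_congr rfl fun i _ => ?_
    rw [map_smul, smul_eq_mul, mul_comm]
  refine ⟨∑ i, C (f (Pi.single i 1)) * X i, ?_, ?_, ?_⟩
  · exact IsHomogeneous.sum _ _ _ fun i _ => isHomogeneous_C_mul_X _ _
  · rw [hasMultGE_one_iff, hev]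
    exact hfp (Submodule.mem_span_singleton_self _)
  · rwa [hasMultGE_one_iff, hev]

theorem not_hasMultGE_one_mul {F G : MvPolynomial (Fin 3) K} {q : PlanePoint K}
    (hF : ¬ HasMultGE F q 1) (hG : ¬ HasMultGE G q 1) : ¬ HasMultGE (F * G) q 1 := by
  rw [hasMultGE_one_iff] at *
  rw [map_mul]
  exact mul_ne_zero hF hG

/-- A product of powers of lines, each through one p j and avoiding p i, padded to degree r by a
power of a coordinate that does not vanish at p i. -/
theorem exists_separating_form {k : ℕ} {p : Fin k → PlanePoint K} (hp : Function.Injective p)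
    (m : Fin k → ℕ) (i : Fin k) (s : Finset (Fin k)) (hi : i ∉ s) (r : ℕ) (hr : ∑ j ∈ s, m j ≤ r) :
    ∃ Q : MvPolynomial (Fin 3) K, Q.IsHomogeneous r ∧ (∀ j ∈ s, HasMultGE Q (p j) (m j)) ∧
      ¬ HasMultGE Q (p i) 1 := by
  induction s using Finset.induction_on generalizing r with
  | empty =>
    obtain ⟨a, ha⟩ := Function.ne_iff.1 (p i).rep_nonzero
    refine ⟨X a ^ r, by simpa using (isHomogeneous_X_pow a r), by simp, ?_⟩
    rw [hasMultGE_one_iff]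
    simpa using fun h => absurd h ha
  | insert j s hj ih =>
    rw [Finset.sum_insert hj] at hr
    obtain ⟨Q, h1, h2, h3⟩ := ih (fun h => hi (Finset.mem_insert_of_mem h)) (r - m j) (by omega)
    have hij : j ≠ i := fun h => hi (h ▸ Finset.mem_insert_self _ _)
    obtain ⟨l, hl1, hl2, hl3⟩ := exists_linear_form (fun h => hij (hp h) : p j ≠ p i)
    have hpow : ∀ n, (l ^ n).IsHomogeneous n ∧ HasMultGE (l ^ n) (p j) n ∧
        ¬ HasMultGE (l ^ n) (p i) 1 := by
      intro n
      induction n with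
      | zero =>
        refine ⟨by simpa using isHomogeneous_one _ _, hasMultGE_zero _ _, ?_⟩
        rw [hasMultGE_one_iff]; simp
      | succ n ihn =>
        rw [pow_succ]
        exact ⟨ihn.1.mul hl1, ihn.2.1.mul hl2, not_hasMultGE_one_mul ihn.2.2 hl3⟩
    refine ⟨l ^ m j * Q, ?_, ?_, not_hasMultGE_one_mul (hpow _).2.2 h3⟩
    · have := (hpow (m j)).1.mul h1
      rwa [show m j + (r - m j) = r by omega] at this
    · intro a ha
      rcases Finset.mem_insert.1 ha with rfl | ha
      · simpa using (hpow (m a)).2.1.mul (hasMultGE_zero Q (p a))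
      · simpa using (hasMultGE_zero (l ^ m j) (p a)).mul (h2 a ha)

/-- Multiplicity conditions at distinct points are independent in large degree. -/
theorem finrank_linearSystem_add_le {k : ℕ} {p : Fin k → PlanePoint K}
    (hp : Function.Injective p) (t : ℕ) (m : Fin k → ℕ) (s : Finset (Fin k))
    (hs : ∑ j ∈ s, m j ≤ t + 1) :
    Module.finrank K (linearSystem t (fun i => if i ∈ s then m i else 0) p)
      + ∑ i ∈ s, (m i + 1).choose 2 ≤ (t + 2).choose 2 := by
  induction s using Finset.induction_on with
  | empty =>
    rw [Finset.sum_empty, add_zero, ← finrank_forms K t]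
    exact Submodule.finrank_mono (linearSystem_le _ _ _)
  | insert i s hi ih =>
    rw [Finset.sum_insert hi] at hs
    have ih := ih (by omega)
    rw [Finset.sum_insert hi]
    rcases Nat.eq_zero_or_pos (m i) with h0 | hpos
    · have heq : (fun a => if a ∈ insert i s then m a else 0) = fun a => if a ∈ s then m a else 0 := by
        funext j
        rcases eq_or_ne j i with rfl | h
        · simp [h0]
        · simp [h]
      rw [h0, zero_add, Nat.choose_eq_zero_of_lt (by omega : 1 < 2), zero_add, heq]
      exact ih
    obtain ⟨Q, hQ1, hQ2, hQ3⟩ := exists_separating_form hp m i s hi (t - (m i - 1)) (by omega)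
    set V := linearSystem t (fun a => if a ∈ s then m a else 0) p
    set V' := linearSystem t (fun a => if a ∈ insert i s then m a else 0) p
    -- If Q does not vanish at p i and Q H has multiplicity m i there, then so has H. Its degree is
    -- only m i - 1, so H = 0. Thus U is a complement to the new conditions, of dimension m i (m i +
    -- 1) / 2.
    set U := (homogeneousSubmodule (Fin 3) K (m i - 1)).map (LinearMap.mulLeft K Q)
    have hQ0 : Q ≠ 0 := by
      rintro rfl; exact hQ3 (HasMultGE.zero _ _)
    have hV' : V' ≤ V := linearSystem_mono (fun a => by
      by_cases h : a ∈ s <;> simp [h]) p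
    have hU : U ≤ V := by
      rintro _ ⟨H, hH, rfl⟩
      refine ⟨?_, fun a => ?_⟩
      · have := hQ1.mul hH
        rwa [show t - (m i - 1) + (m i - 1) = t by omega] at this
      · dsimp only
        split_ifs with ha
        · simpa using (hQ2 a ha).mul (hasMultGE_zero H (p a))
        · exact hasMultGE_zero _ _
    have hdisj : Disjoint U V' := by
      rw [Submodule.disjoint_def]
      rintro _ ⟨H, hH, rfl⟩ hmem
      have h1 : HasMultGE (Q * H) (p i) (0 + m i) := by
        simpa using hmem.2 i
      have h2 := eq_zero_of_degree_lt_mult hH (h1.of_mul hQ3) (by omega)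
      simp [h2]
    have hfU : Module.finrank K U = (m i + 1).choose 2 := by
      have hinj : Function.Injective (LinearMap.mulLeft K Q) := fun a b hab =>
        mul_left_cancel₀ hQ0 hab
      rw [← (Submodule.equivMapOfInjective _ hinj _).finrank_eq, finrank_forms,
        show m i - 1 + 2 = m i + 1 by omega]
    have hsum := Submodule.finrank_sup_add_finrank_inf_eq U V'
    rw [hdisj.eq_bot, finrank_bot] at hsum
    have hle : Module.finrank K ↥(U ⊔ V') ≤ Module.finrank K V :=
      Submodule.finrank_mono (sup_le hU hV')
    omega

theorem finrank_linearSystem_le {k : ℕ} {p : Fin k → PlanePoint K}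
    (hp : Function.Injective p) (t : ℕ) (m : Fin k → ℕ) (hm : ∑ j, m j ≤ t + 1) :
    Module.finrank K (linearSystem t m p) + ∑ i, (m i + 1).choose 2 ≤ (t + 2).choose 2 := by
  have := finrank_linearSystem_add_le hp t m Finset.univ hm
  have heq : (fun i => if i ∈ Finset.univ then m i else 0) = m := by simp
  rwa [heq] at this

theorem choose_two_add (m n : ℕ) :
    (m + n + 1).choose 2 = (m + 1).choose 2 + (n + 1).choose 2 + m * n := by
  have h : ∀ a : ℕ, ((a + 1).choose 2 : ℚ) = (a + 1) * a / 2 := by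
    intro a
    rw [Nat.cast_choose_two]; push_cast; ring
  have : ((m + n + 1).choose 2 : ℚ) = (m + 1).choose 2 + (n + 1).choose 2 + m * n := by
    rw [h, h, h]; push_cast; ring
  exact_mod_cast this

/-- Bézout's inequality with multiplicities. -/
theorem sum_mult_mul_le [CharZero K] {k : ℕ} {p : Fin k → PlanePoint K}
    (hp : Function.Injective p) {d e : ℕ} {m n : Fin k → ℕ} {F G : MvPolynomial (Fin 3) K}
    (hF : F ∈ linearSystem d m p) (hG : G ∈ linearSystem e n p) (hirr : Irreducible F)
    (hdvd : ¬ F ∣ G) : ∑ i, m i * n i ≤ d * e := by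
  -- The degree is raised by r so that the conditions of multiplicity m + n are independent in
  -- degree d + e + r.
  set r := ∑ i, (m i + n i)
  have hA := finrank_forms_le (e + r) n p
  have hB := finrank_forms_le (d + r) m p
  have hC := finrank_linearSystem_le hp (d + e + r) (m + n) (by
    simp only [Pi.add_apply]; omega)
  have hmn : ∑ i, ((m + n) i + 1).choose 2 =
      ∑ i, (m i + 1).choose 2 + ∑ i, (n i + 1).choose 2 + ∑ i, m i * n i := by
    rw [← Finset.sum_add_distrib, ← Finset.sum_add_distrib]
    exact Finset.sum_congr rfl fun i _ => choose_two_add _ _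
  rw [hmn] at hC
  -- The map (A, B) ↦ F A + G B. A lower bound for its source and upper bounds for its target and
  -- kernel give the inequality.
  let f : (linearSystem (e + r) n p × linearSystem (d + r) m p) →ₗ[K]
      linearSystem (d + e + r) (m + n) p :=
    LinearMap.codRestrict _
      ((LinearMap.mulLeft K F ∘ₗ (linearSystem (e + r) n p).subtype).coprod
        (LinearMap.mulLeft K G ∘ₗ (linearSystem (d + r) m p).subtype)) (by
      rintro ⟨⟨A, hA⟩, ⟨B, hB⟩⟩
      simp only [LinearMap.coprod_apply, LinearMap.comp_apply, Submodule.subtype_apply,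
        LinearMap.mulLeft_apply]
      refine add_mem ?_ ?_
      · have := mul_mem_linearSystem hF hA
        rwa [← add_assoc] at this
      · have := mul_mem_linearSystem hG hB
        rwa [← add_assoc, add_comm e d, add_comm n m] at this)
  have hf : ∀ x, f x = 0 → F * (x.1 : MvPolynomial (Fin 3) K) + G * x.2 = 0 := fun x hx =>
    congrArg Subtype.val hx
  have hrank := f.finrank_range_add_finrank_ker
  have h1 : Module.finrank K (LinearMap.range f) ≤ _ := Submodule.finrank_le _
  -- If F A + G B = 0, then F, being prime and not dividing G, divides B. So B = F H with H of
  -- degree r, and B determines A.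
  have h2 : Module.finrank K (LinearMap.ker f) ≤ (r + 2).choose 2 := by
    let U := (homogeneousSubmodule (Fin 3) K r).map (LinearMap.mulLeft K F)
    have hU : Module.finrank K U ≤ (r + 2).choose 2 := by
      rw [← finrank_forms K r]
      exact Submodule.finrank_map_le _ _
    refine le_trans ?_ hU
    let g : LinearMap.ker f →ₗ[K] U :=
      LinearMap.codRestrict _ ((linearSystem (d + r) m p).subtype ∘ₗ LinearMap.snd K _ _ ∘ₗ
        (LinearMap.ker f).subtype) (by
        rintro ⟨⟨⟨A, hA⟩, ⟨B, hB⟩⟩, hx⟩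
        have h0 := hf _ hx
        simp only [LinearMap.comp_apply, Submodule.subtype_apply, LinearMap.snd_apply]
        dsimp only at h0
        have hd : F ∣ G * B := ⟨-A, by linear_combination h0⟩
        rcases hirr.prime.dvd_or_dvd hd with h | ⟨H, rfl⟩
        · exact absurd h hdvd
        · refine ⟨H, ?_, rfl⟩
          rcases eq_or_ne H 0 with rfl | hH
          · exact Submodule.zero_mem _
          obtain ⟨a, b, hab, ha, hb⟩ := isHomogeneous_of_mul hB.1 hirr.ne_zero hH
          have := ha.inj_right hF.1 hirr.ne_zero
          have : b = r := by omega
          rwa [this] at hb)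
    refine LinearMap.finrank_le_finrank_of_injective (f := g) ?_
    rintro ⟨⟨⟨A, hA⟩, ⟨B, hB⟩⟩, hx⟩ ⟨⟨⟨A', hA'⟩, ⟨B', hB'⟩⟩, hx'⟩ h
    have hBB : B = B' := congrArg (fun z : U => (z : MvPolynomial (Fin 3) K)) h
    subst hBB
    have h0 := hf _ hx
    have h0' := hf _ hx'
    dsimp only at h0 h0'
    have hAA : A = A' := mul_left_cancel₀ hirr.ne_zero (by linear_combination h0 - h0')
    subst hAA
    rfl
  rw [Module.finrank_prod] at hrank
  have key : (d + e + r + 2).choose 2 + (r + 2).choose 2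
      = (e + r + 2).choose 2 + (d + r + 2).choose 2 + d * e := by
    have ha := choose_two_add (e + r + 1) d
    have hb := choose_two_add d (r + 1)
    rw [show e + r + 1 + d + 1 = d + e + r + 2 by ring] at ha
    rw [show d + (r + 1) + 1 = d + r + 2 by ring] at hb
    have : (e + r + 1) * d = d * e + d * (r + 1) := by ring
    rw [show e + r + 1 + 1 = e + r + 2 by ring] at ha
    rw [show r + 1 + 1 = r + 2 by ring] at hb
    omega
  omega

end Forms

/-! ### Properties of general points. -/

section GeneralPoints

variable {K : Type*} [Field K]

theorem ForGeneralPoints.mono {k : ℕ} {P Q : (Fin k → PlanePoint K) → Prop}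
    (h : ForGeneralPoints K k P) (hPQ : ∀ p, P p → Q p) : ForGeneralPoints K k Q := by
  obtain ⟨G, hG, h⟩ := h
  exact ⟨G, hG, fun v hv hne => hPQ _ (h v hv hne)⟩

theorem ForGeneralPoints.and {k : ℕ} {P Q : (Fin k → PlanePoint K) → Prop}
    (hP : ForGeneralPoints K k P) (hQ : ForGeneralPoints K k Q) :
    ForGeneralPoints K k fun p => P p ∧ Q p := by
  obtain ⟨G, hG, hP⟩ := hP
  obtain ⟨H, hH, hQ⟩ := hQ
  refine ⟨G * H, mul_ne_zero hG hH, fun v hv hne => ?_⟩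
  rw [map_mul] at hne
  exact ⟨hP v hv (left_ne_zero_of_mul hne), hQ v hv (right_ne_zero_of_mul hne)⟩

theorem forGeneralPoints_of_forall {k : ℕ} {P : (Fin k → PlanePoint K) → Prop} (h : ∀ p, P p) :
    ForGeneralPoints K k P :=
  ⟨1, one_ne_zero, fun _ _ _ => h _⟩

theorem forGeneralPoints_finset {k : ℕ} {ι : Type*} (s : Finset ι)
    {P : ι → (Fin k → PlanePoint K) → Prop} (h : ∀ i ∈ s, ForGeneralPoints K k (P i)) :
    ForGeneralPoints K k fun p => ∀ i ∈ s, P i p := by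
  classical
  induction s using Finset.induction_on with
  | empty => exact forGeneralPoints_of_forall (by simp)
  | insert a s ha ih =>
    refine ((h a (Finset.mem_insert_self _ _)).and
      (ih fun i hi => h i (Finset.mem_insert_of_mem hi))).mono ?_
    rintro p ⟨h1, h2⟩ i hi
    rcases Finset.mem_insert.1 hi with rfl | hi
    · exact h1
    · exact h2 i hi

theorem forGeneralPoints_fintype {k : ℕ} {ι : Type*} [Finite ι]
    {P : ι → (Fin k → PlanePoint K) → Prop} (h : ∀ i, ForGeneralPoints K k (P i)) :
    ForGeneralPoints K k fun p => ∀ i, P i p := by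
  have := Fintype.ofFinite ι
  exact (forGeneralPoints_finset Finset.univ fun i _ => h i).mono fun p hp i =>
    hp i (Finset.mem_univ i)

theorem ForGeneralPoints.comp {k n : ℕ} {P : (Fin k → PlanePoint K) → Prop}
    (h : ForGeneralPoints K k P) {f : Fin k → Fin n} (hf : Function.Injective f) :
    ForGeneralPoints K n fun p => P (p ∘ f) := by
  obtain ⟨G, hG, h⟩ := h
  refine ⟨rename (Prod.map f id) G, ?_, fun v hv hne => ?_⟩
  · rw [Ne, map_eq_zero_iff _ (rename_injective _ (hf.prodMap Function.injective_id))]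
    exact hG
  · rw [eval_rename] at hne
    exact h (fun i => v (f i)) (fun i => hv _) hne

/-- A property of general tuples holds at some tuple, and remains true when one point is replaced
by a suitable point outside a given curve. -/
theorem ForGeneralPoints.exists_update [Infinite K] {k : ℕ} {P : (Fin k → PlanePoint K) → Prop}
    (h : ForGeneralPoints K k P) :
    ∃ p, P p ∧ ∀ (i : Fin k) (d : ℕ) (F : MvPolynomial (Fin 3) K), F ≠ 0 → F.IsHomogeneous d →
      ∃ q, ¬ HasMultGE F q 1 ∧ P (Function.update p i q) := by
  obtain ⟨G, hG, h⟩ := h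
  -- The extra factor ensures that all coordinate vectors of the chosen tuple are nonzero.
  have hne : (G * ∏ i : Fin k, X (i, 0)) ≠ 0 :=
    mul_ne_zero hG (Finset.prod_ne_zero_iff.2 fun i _ => X_ne_zero _)
  obtain ⟨w, hw⟩ : ∃ w, eval w (G * ∏ i : Fin k, X (i, 0)) ≠ 0 := by
    by_contra! hcon
    exact hne (MvPolynomial.funext fun x => by rw [hcon x, map_zero])
  rw [map_mul, map_prod] at hw
  set v : Fin k → Fin 3 → K := fun i a => w (i, a)
  have hv : ∀ i, v i ≠ 0 := fun i h0 => by
    refine right_ne_zero_of_mul hw (Finset.prod_eq_zero (Finset.mem_univ i) ?_)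
    rw [eval_X]; exact congrFun h0 0
  refine ⟨fun i => Projectivization.mk K (v i) (hv i), h v hv (left_ne_zero_of_mul hw), ?_⟩
  intro i d F hF hFd
  -- `Gi` is `G` with all points but the i-th frozen. A vector where `Gi`, F and the first
  -- coordinate are all nonzero gives the new point.
  let Gi : MvPolynomial (Fin 3) K :=
    aeval (fun ja : Fin k × Fin 3 => if ja.1 = i then X ja.2 else C (v ja.1 ja.2)) G
  have hGi : ∀ x : Fin 3 → K,
      eval x Gi = eval (fun ja : Fin k × Fin 3 => Function.update v i x ja.1 ja.2) G := by
    intro x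
    simp only [Gi]
    rw [← aeval_eq_eval, ← aeval_eq_eval, ← AlgHom.comp_apply, comp_aeval]
    congr 2
    funext ja
    rcases eq_or_ne ja.1 i with h1 | h1
    · simp [h1]
    · simp [h1]
  have hGi0 : Gi ≠ 0 := by
    intro h0
    have := hGi (v i)
    rw [h0, map_zero, Function.update_eq_self] at this
    exact left_ne_zero_of_mul hw this.symm
  obtain ⟨x, hx⟩ : ∃ x, eval x (Gi * F * X 0) ≠ 0 := by
    by_contra! hcon
    exact mul_ne_zero (mul_ne_zero hGi0 hF) (X_ne_zero (0 : Fin 3))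
      (MvPolynomial.funext fun x => by rw [hcon x, map_zero])
  rw [map_mul, map_mul, eval_X] at hx
  have hx0 : x ≠ 0 := fun h0 => right_ne_zero_of_mul hx (congrFun h0 0)
  refine ⟨Projectivization.mk K x hx0, ?_, ?_⟩
  · rw [hasMultGE_mk_iff hFd hx0]
    intro h0
    have := h0 0 (by simp)
    rw [coeff_zero_taylorAt] at this
    exact right_ne_zero_of_mul (left_ne_zero_of_mul hx) this
  · have hu : ∀ j, Function.update v i x j ≠ 0 := by
      intro j
      rcases eq_or_ne j i with rfl | hj
      · simpa using hx0
      · simpa [hj] using hv j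
    have := h (Function.update v i x) hu (by
      rw [← hGi]; exact left_ne_zero_of_mul (left_ne_zero_of_mul hx))
    convert this using 1
    funext j
    rcases eq_or_ne j i with rfl | hj
    · simp
    · simp [hj]

theorem ForGeneralPoints.exists [Infinite K] {k : ℕ} {P : (Fin k → PlanePoint K) → Prop}
    (h : ForGeneralPoints K k P) : ∃ p, P p := by
  obtain ⟨p, hp, -⟩ := h.exists_update
  exact ⟨p, hp⟩

theorem forGeneralPoints_injective (k : ℕ) :
    ForGeneralPoints K k fun p => Function.Injective p := by
  have key : ∀ x : Fin k × Fin k, ForGeneralPoints K k fun p => x.1 ≠ x.2 → p x.1 ≠ p x.2 := by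
    rintro ⟨i, j⟩
    rcases eq_or_ne i j with rfl | hij
    · exact forGeneralPoints_of_forall (by simp)
    refine ⟨X (i, 0) * X (j, 1) - X (i, 1) * X (j, 0), ?_, ?_⟩
    · intro h0
      have := congrArg (eval (fun ja : Fin k × Fin 3 =>
        if ja = (i, 0) ∨ ja = (j, 1) then (1 : K) else 0)) h0
      simp [hij, hij.symm] at this
    · intro v hv hne _ heq
      obtain ⟨a, ha⟩ := (Projectivization.mk_eq_mk_iff' K _ _ _ _).1 heq
      refine hne ?_
      dsimp only at ha
      simp only [map_sub, map_mul, eval_X, ← ha, Pi.smul_apply, smul_eq_mul]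
      ring
  refine (forGeneralPoints_fintype key).mono fun p hp i j hij => ?_
  by_contra hne
  exact hp (i, j) hne hij

/-- Emptiness of a linear system is an open condition on the points. -/
theorem forGeneralPoints_linearSystem_eq_bot {k : ℕ} {d : ℕ} {m : Fin k → ℕ}
    {p₀ : Fin k → PlanePoint K} (h : linearSystem d m p₀ = ⊥) :
    ForGeneralPoints K k fun p => linearSystem d m p = ⊥ := by
  classical
  let B : Type := (Finset.univ : Finset (Fin 3)).finsuppAntidiag d
  let J : Type := Σ i, ((Finset.range (m i)).biUnion fun t =>
    (Finset.univ : Finset (Fin 3)).finsuppAntidiag t : Finset (Fin 3 →₀ ℕ))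
  have hJ : ∀ i (s : Fin 3 →₀ ℕ), s.degree < m i → s ∈ (Finset.range (m i)).biUnion fun t =>
      (Finset.univ : Finset (Fin 3)).finsuppAntidiag t := by
    intro i s hs
    rw [Finset.mem_biUnion]
    exact ⟨s.degree, Finset.mem_range.2 hs, by
      simp [Finset.mem_finsuppAntidiag, Finsupp.degree_eq_sum]⟩
  let M : (Fin k → Fin 3 → K) → Matrix J B K := fun v => Matrix.of fun x b =>
    (taylorAt (v x.1) (monomial b.1 1)).coeff x.2.1
  let Q : Matrix J B (MvPolynomial (Fin k × Fin 3) K) := Matrix.of fun x b =>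
    (aeval (fun a => X a + C (X (x.1, a)) :
      Fin 3 → MvPolynomial (Fin 3) (MvPolynomial (Fin k × Fin 3) K))
        (monomial b.1 (1 : K))).coeff x.2.1
  have hQ : ∀ v : Fin k → Fin 3 → K, Q.map (eval fun ij : Fin k × Fin 3 => v ij.1 ij.2) = M v := by
    intro v
    ext x b
    simp only [Matrix.map_apply, Q, M, Matrix.of_apply]
    rw [← coeff_map]
    congr 1
    simp only [taylorAt, aeval_monomial, map_one, one_mul, Finsupp.prod, map_prod, map_pow,
      map_add, map_X, map_C, eval_X]
  have hform : ∀ c : B → K, (∑ b, monomial b.1 (c b) : MvPolynomial (Fin 3) K).IsHomogeneous d := by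
    intro c
    refine IsHomogeneous.sum _ _ _ fun b _ => isHomogeneous_monomial _ ?_
    have := b.2
    rw [Finset.mem_finsuppAntidiag] at this
    rw [Finsupp.degree_eq_sum]; exact this.1
  have hM : ∀ v (c : B → K) (x : J), (M v).mulVec c x =
      (taylorAt (v x.1) (∑ b, monomial b.1 (c b))).coeff x.2.1 := by
    intro v c x
    rw [map_sum, coeff_sum]
    simp only [Matrix.mulVec, dotProduct, M, Matrix.of_apply]
    refine Finset.sum_congr rfl fun b _ => ?_
    rw [show monomial b.1 (c b) = c b • monomial b.1 (1 : K) by rw [smul_monomial, smul_eq_mul,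
      mul_one], map_smul, coeff_smul, smul_eq_mul, mul_comm]
  have hinj : Function.Injective (Matrix.mulVecLin (M fun i => (p₀ i).rep)) := by
    rw [injective_iff_map_eq_zero]
    intro c hc
    have hmem : (∑ b, monomial b.1 (c b) : MvPolynomial (Fin 3) K) ∈ linearSystem d m p₀ := by
      refine ⟨hform c, fun i s hs => ?_⟩
      have h1 : (M fun i => (p₀ i).rep).mulVec c ⟨i, ⟨s, hJ i s hs⟩⟩ = 0 := by
        rw [← Matrix.mulVecLin_apply, hc, Pi.zero_apply]
      have h2 := hM (fun i => (p₀ i).rep) c ⟨i, ⟨s, hJ i s hs⟩⟩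
      rw [h1] at h2
      exact h2.symm
    rw [h, Submodule.mem_bot] at hmem
    funext b
    have := congrArg (coeff b.1) hmem
    rw [coeff_sum, Finset.sum_eq_single b] at this
    · simpa using this
    · intro b' _ hb
      rw [coeff_monomial, if_neg fun h => hb (Subtype.ext h)]
    · simp
  -- The system at p₀ is empty exactly when the matrix of conditions is injective. A constant left
  -- inverse N makes this visible in the determinant of N M(v), a polynomial in the points that
  -- equals 1 at p₀.
  obtain ⟨g, hg⟩ := LinearMap.exists_leftInverse_of_injective _ (LinearMap.ker_eq_bot.2 hinj)
  let N : Matrix B J K := LinearMap.toMatrix' g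
  have hN : N * M (fun i => (p₀ i).rep) = 1 := by
    have := congrArg LinearMap.toMatrix' hg
    rwa [LinearMap.toMatrix'_comp, LinearMap.toMatrix'_id, ← Matrix.toLin'_apply',
      LinearMap.toMatrix'_toLin'] at this
  let R : Matrix B J (MvPolynomial (Fin k × Fin 3) K) := N.map C
  have hG : ∀ v : Fin k → Fin 3 → K, eval (fun ij : Fin k × Fin 3 => v ij.1 ij.2)
      (R * Q).det = (N * M v).det := by
    intro v
    rw [← hQ, RingHom.map_det]
    congr 1
    rw [RingHom.mapMatrix_apply, Matrix.map_mul, Matrix.map_map]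
    congr 1
    ext; simp
  refine ⟨(R * Q).det, ?_, ?_⟩
  · intro h0
    have := hG fun i => (p₀ i).rep
    rw [h0, map_zero, hN, Matrix.det_one] at this
    exact zero_ne_one this
  · intro v hv hne
    rw [hG] at hne
    rw [eq_bot_iff]
    intro F hF
    have hFc : F = ∑ b : B, monomial b.1 (F.coeff b.1) := by
      ext s
      rw [coeff_sum]
      by_cases hs : s ∈ (Finset.univ : Finset (Fin 3)).finsuppAntidiag d
      · rw [Finset.sum_eq_single ⟨s, hs⟩]
        · simp
        · intro b' _ hb
          rw [coeff_monomial, if_neg fun h => hb (Subtype.ext h)]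
        · simp
      · rw [Finset.sum_eq_zero]
        · refine hF.1.coeff_eq_zero fun h => hs ?_
          simp [Finset.mem_finsuppAntidiag, ← h, Finsupp.degree_eq_sum]
        · intro b _
          rw [coeff_monomial, if_neg fun h => hs (by rw [← h]; exact b.2)]
    have hz : (M v).mulVec (fun b => F.coeff b.1) = 0 := by
      funext x
      rw [hM, ← hFc]
      refine (hasMultGE_mk_iff hF.1 (hv x.1)).1 (hF.2 x.1) _ ?_
      have := x.2.2
      rw [Finset.mem_biUnion] at this
      obtain ⟨t, ht, hxt⟩ := this
      rw [Finset.mem_finsuppAntidiag] at hxt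
      rw [Finsupp.degree_eq_sum, hxt.1]
      exact Finset.mem_range.1 ht
    have hc : (fun b : B => F.coeff b.1) = 0 := by
      refine Matrix.eq_zero_of_mulVec_eq_zero hne ?_
      rw [← Matrix.mulVec_mulVec, hz, Matrix.mulVec_zero]
    rw [Submodule.mem_bot, hFc]
    refine Finset.sum_eq_zero fun b _ => ?_
    rw [show F.coeff b.1 = 0 from congrFun hc b, monomial_zero]

/-- Simple points impose independent conditions on any space of forms. -/
theorem exists_points_eq_zero [Infinite K] {d : ℕ} (k : ℕ) (V : Submodule K (MvPolynomial (Fin 3) K))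
    (hV : V ≤ homogeneousSubmodule (Fin 3) K d) (hk : Module.finrank K V ≤ k) :
    ∃ q : Fin k → PlanePoint K, ∀ F ∈ V, (∀ i, HasMultGE F (q i) 1) → F = 0 := by
  induction k generalizing V with
  | zero =>
    have : FiniteDimensional K V := Submodule.finiteDimensional_of_le hV
    have h0 : V = ⊥ := Submodule.finrank_eq_zero.1 (Nat.le_zero.1 hk)
    exact ⟨Fin.elim0, fun F hF _ => by rwa [h0, Submodule.mem_bot] at hF⟩
  | succ k ih =>
    have : FiniteDimensional K V := Submodule.finiteDimensional_of_le hV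
    rcases eq_or_ne V ⊥ with h0 | h0
    · refine ⟨fun _ => Projectivization.mk K (fun _ => 1) (by
        intro h; exact one_ne_zero (congrFun h 0)), fun F hF _ => by
          rwa [h0, Submodule.mem_bot] at hF⟩
    obtain ⟨F, hF, hF0⟩ := Submodule.exists_mem_ne_zero_of_ne_bot h0
    obtain ⟨x, hx⟩ : ∃ x, eval x (F * X 0) ≠ 0 := by
      by_contra! hcon
      exact mul_ne_zero hF0 (X_ne_zero (0 : Fin 3))
        (MvPolynomial.funext fun x => by rw [hcon x, map_zero])
    rw [map_mul, eval_X] at hx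
    have hx0 : x ≠ 0 := fun h0 => right_ne_zero_of_mul hx (congrFun h0 0)
    set q₀ : PlanePoint K := Projectivization.mk K x hx0
    have hFq : ¬ HasMultGE F q₀ 1 := by
      rw [hasMultGE_mk_iff (hV hF) hx0]
      intro h0
      have := h0 0 (by simp)
      rw [coeff_zero_taylorAt] at this
      exact left_ne_zero_of_mul hx this
    -- Vanishing at a point off some member F cuts the dimension down, and induction supplies the
    -- remaining points.
    let V' := V ⊓ LinearMap.ker (aeval q₀.rep : MvPolynomial (Fin 3) K →ₐ[K] K).toLinearMap
    have hlt : V' < V := by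
      refine lt_of_le_of_ne inf_le_left fun h => hFq ?_
      rw [hasMultGE_one_iff]
      have : F ∈ V' := h ▸ hF
      simpa [aeval_eq_eval] using this.2
    have := Submodule.finrank_lt_finrank_of_lt hlt
    obtain ⟨q, hq⟩ := ih V' (inf_le_left.trans hV) (by omega)
    refine ⟨Fin.cons q₀ q, fun H hH hm => hq H ⟨hH, ?_⟩ fun i => by simpa using hm i.succ⟩
    have := hm 0
    rw [Fin.cons_zero, hasMultGE_one_iff] at this
    simpa [aeval_eq_eval] using this

/-- The system of curves with one multiple point and sufficiently many simple general points
is empty. -/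
theorem forGeneralPoints_quasiHom_eq_bot [Infinite K] (d m₀ k : ℕ) (hm : m₀ ≤ d + 1)
    (h : (d + 2).choose 2 ≤ (m₀ + 1).choose 2 + k) :
    ForGeneralPoints K (k + 1) fun p => linearSystem d (quasiHomMult m₀ k 1) p = ⊥ := by
  let q₀ : PlanePoint K := Projectivization.mk K (fun _ => 1) (by
        intro h; exact one_ne_zero (congrFun h 0))
  have h1 := finrank_linearSystem_le (p := fun _ : Fin 1 => q₀)
    (Function.injective_of_subsingleton _) d (fun _ => m₀) (by simpa using hm)
  simp only [Finset.univ_unique, Finset.sum_const, Finset.card_singleton, one_smul] at h1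
  obtain ⟨q, hq⟩ := exists_points_eq_zero (d := d) k (linearSystem d (fun _ : Fin 1 => m₀)
    fun _ => q₀) (linearSystem_le _ _ _) (by omega)
  refine forGeneralPoints_linearSystem_eq_bot (p₀ := Fin.cons q₀ q) ?_
  rw [eq_bot_iff]
  intro F hF
  refine hq F ⟨hF.1, fun _ => by simpa [quasiHomMult] using hF.2 0⟩ fun i => ?_
  simpa [quasiHomMult] using hF.2 i.succ

end GeneralPoints

/-! ### Existence of the three families of (-1)-curves. -/

section Curves

variable {K : Type*} [Field K]

theorem HasMultGE.of_dvd {F G : MvPolynomial (Fin 3) K} {p : PlanePoint K} {m : ℕ}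
    (h : HasMultGE F p m) (hd : F ∣ G) : HasMultGE G p m := by
  obtain ⟨H, rfl⟩ := hd
  simpa using h.mul (hasMultGE_zero H p)

theorem hasMultGE_one_mul {F G : MvPolynomial (Fin 3) K} {p : PlanePoint K}
    (h : HasMultGE (F * G) p 1) : HasMultGE F p 1 ∨ HasMultGE G p 1 :=
  hasMultGE_mul_dichotomy (m := 0) (n := 0) h

theorem degree_le_of_dvd {F G : MvPolynomial (Fin 3) K} {d e : ℕ} (hF : F.IsHomogeneous d)
    (hG : G.IsHomogeneous e) (hG0 : G ≠ 0) (h : F ∣ G) : d ≤ e := by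
  obtain ⟨H, rfl⟩ := h
  have hF0 := left_ne_zero_of_mul hG0
  obtain ⟨a, b, hab, ha, -⟩ := isHomogeneous_of_mul hG hF0 (right_ne_zero_of_mul hG0)
  have := ha.inj_right hF hF0
  omega

theorem isUnit_of_isHomogeneous_zero {F : MvPolynomial (Fin 3) K} (h : F.IsHomogeneous 0)
    (h0 : F ≠ 0) : IsUnit F := by
  rw [← totalDegree_zero_iff_isHomogeneous, totalDegree_eq_zero_iff_eq_C] at h
  rw [h]
  refine (isUnit_iff_ne_zero.2 fun hc => h0 ?_).map C
  rw [h, hc, C_0]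

theorem degree_pos_of_irreducible {F : MvPolynomial (Fin 3) K} {d : ℕ} (hF : F.IsHomogeneous d)
    (h : Irreducible F) : 1 ≤ d := by
  by_contra! hd
  obtain rfl : d = 0 := by omega
  exact h.not_isUnit (isUnit_of_isHomogeneous_zero hF h.ne_zero)

theorem irreducible_of_forall {F : MvPolynomial (Fin 3) K} {d : ℕ} (hF : F.IsHomogeneous d)
    (h0 : F ≠ 0) (hd : 1 ≤ d)
    (h : ∀ a b A B, a + b = d → 1 ≤ a → 1 ≤ b → A.IsHomogeneous a → B.IsHomogeneous b →
      A ≠ 0 → B ≠ 0 → F ≠ A * B) : Irreducible F := by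
  refine ⟨fun hu => ?_, fun A B hAB => ?_⟩
  · have := degree_le_of_dvd hF (isHomogeneous_one _ _) one_ne_zero (isUnit_iff_dvd_one.1 hu)
    omega
  · have hA := left_ne_zero_of_mul (hAB ▸ h0)
    have hB := right_ne_zero_of_mul (hAB ▸ h0)
    obtain ⟨a, b, hab, ha, hb⟩ := isHomogeneous_of_mul (hAB ▸ hF) hA hB
    rcases Nat.eq_zero_or_pos a with rfl | ha'
    · exact Or.inl (isUnit_of_isHomogeneous_zero ha hA)
    rcases Nat.eq_zero_or_pos b with rfl | hb'
    · exact Or.inr (isUnit_of_isHomogeneous_zero hb hB)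
    exact absurd hAB (h a b A B hab ha' hb' ha hb hA hB)

theorem exists_mem_linearSystem_ne_zero [CharZero K] {k : ℕ} {d : ℕ} {m : Fin k → ℕ}
    (h : ∑ i, (m i + 1).choose 2 < (d + 2).choose 2) (p : Fin k → PlanePoint K) :
    ∃ F ∈ linearSystem d m p, F ≠ 0 := by
  have h1 := finrank_forms_le d m p
  refine Submodule.exists_mem_ne_zero_of_ne_bot fun h0 => ?_
  rw [h0, finrank_bot] at h1
  omega

/-- An irreducible curve with too large multiplicities at two points is a line. -/
theorem degree_le_one_of_mult [CharZero K] {F : MvPolynomial (Fin 3) K} {d m n : ℕ}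
    {P Q : PlanePoint K} (hPQ : P ≠ Q) (hF : F.IsHomogeneous d) (hirr : Irreducible F)
    (hP : HasMultGE F P m) (hQ : HasMultGE F Q n) (hmn : d < m + n) : d ≤ 1 := by
  obtain ⟨l, hl, hl0⟩ := exists_mem_linearSystem_ne_zero (K := K) (d := 1)
    (m := fun _ : Fin 2 => 1) (by decide) ![P, Q]
  by_cases hd : F ∣ l
  · exact degree_le_of_dvd hF hl.1 hl0 hd
  · have hinj : Function.Injective ![P, Q] := by
      intro i j
      fin_cases i <;> fin_cases j <;> simp [hPQ, hPQ.symm]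
    have hFm : F ∈ linearSystem d ![m, n] ![P, Q] := by
      refine ⟨hF, fun i => ?_⟩
      fin_cases i
      · exact hP
      · exact hQ
    have := sum_mult_mul_le hinj hFm hl hirr hd
    simp [Fin.sum_univ_two] at this
    omega

/-- Forms of degree `d` with multiplicity `m₀` at one of the points `p i` and vanishing at `k`
other ones are zero. -/
def NoCurveThrough {N : ℕ} (p : Fin N → PlanePoint K) (d m₀ k : ℕ) : Prop :=
  ∀ (a : Fin N) (T : Finset (Fin N)), a ∉ T → k ≤ T.card → ∀ F : MvPolynomial (Fin 3) K,
    F.IsHomogeneous d → HasMultGE F (p a) m₀ → (∀ i ∈ T, HasMultGE F (p i) 1) → F = 0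

theorem forGeneralPoints_noCurveThrough [Infinite K] (N d m₀ k : ℕ) (hm : m₀ ≤ d + 1)
    (h : (d + 2).choose 2 ≤ (m₀ + 1).choose 2 + k) :
    ForGeneralPoints K N fun p => NoCurveThrough p d m₀ k := by
  have h1 : ForGeneralPoints K N fun p => ∀ f : Fin (k + 1) ↪ Fin N,
      linearSystem d (quasiHomMult m₀ k 1) (p ∘ f) = ⊥ :=
    forGeneralPoints_fintype fun f =>
      (forGeneralPoints_quasiHom_eq_bot d m₀ k hm h).comp f.injective
  refine h1.mono fun p hp a T ha hT F hF hFa hFT => ?_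
  let g : Fin (k + 1) → Fin N := Fin.cons a (T.orderEmbOfCardLe hT)
  have hg : Function.Injective g := by
    rw [Fin.cons_injective_iff]
    refine ⟨?_, (T.orderEmbOfCardLe hT).injective⟩
    rintro ⟨i, hi⟩
    exact ha (hi ▸ T.orderEmbOfCardLe_mem hT i)
  have hmem : F ∈ linearSystem d (quasiHomMult m₀ k 1) (p ∘ g) := by
    refine ⟨hF, fun i => ?_⟩
    refine Fin.cases ?_ (fun i => ?_) i
    · simpa [g, quasiHomMult] using hFa
    · simpa [g, quasiHomMult] using hFT _ (T.orderEmbOfCardLe_mem hT i)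
  have := hp ⟨g, hg⟩
  rw [Function.Embedding.coeFn_mk] at this
  rwa [this, Submodule.mem_bot] at hmem

theorem NoCurveThrough.card_lt {N : ℕ} {p : Fin N → PlanePoint K} {d m₀ k : ℕ}
    (h : NoCurveThrough p d m₀ k) {a : Fin N} {T : Finset (Fin N)} (ha : a ∉ T)
    {F : MvPolynomial (Fin 3) K} (hF : F.IsHomogeneous d) (hF0 : F ≠ 0)
    (hFa : HasMultGE F (p a) m₀) (hFT : ∀ i ∈ T, HasMultGE F (p i) 1) : T.card < k := by
  by_contra! hT
  exact hF0 (h a T ha hT F hF hFa hFT)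

section Classes

theorem sum_quasiHomMult {R : Type*} [AddCommMonoid R] (m₀ n m : ℕ) (f : ℕ → R) :
    ∑ i, f (quasiHomMult m₀ n m i) = f m₀ + n • f m := by
  rw [Fin.sum_univ_succ]
  simp [quasiHomMult]

theorem quasiHomClass_inter (d m₀ n m : ℕ) (A : BlowupClass (n + 1)) :
    (quasiHomClass d m₀ n m).inter A = d * A.1 - m₀ * A.2 0 - m * ∑ i : Fin n, A.2 i.succ := by
  simp only [BlowupClass.inter, quasiHomClass, Fin.sum_univ_succ, quasiHomMult, Fin.cons_zero,
    Fin.cons_succ, Finset.mul_sum]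
  ring

theorem quasiHomClass_inter_quasiHomClass (d m₀ d' m₀' n m m' : ℕ) :
    (quasiHomClass d m₀ n m).inter (quasiHomClass d' m₀' n m') = d * d' - m₀ * m₀' - n * m * m' := by
  rw [quasiHomClass_inter]
  simp [quasiHomClass, quasiHomMult]
  ring

theorem quasiHomClass_genus (d m₀ n m : ℕ) : (quasiHomClass d m₀ n m).genus =
    ((d : ℤ) - 1) * (d - 2) / 2 - m₀ * (m₀ - 1) / 2 - n * (m * (m - 1) / 2) := by
  rw [BlowupClass.genus]
  simp only [quasiHomClass]
  rw [sum_quasiHomMult m₀ n m fun x : ℕ => ((x : ℤ) * (x - 1) / 2)]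
  simp
  ring

theorem quasiHomClass_vdim (d m₀ n m : ℕ) : (quasiHomClass d m₀ n m).vdim =
    (d : ℤ) * (d + 3) / 2 - m₀ * (m₀ + 1) / 2 - n * (m * (m + 1) / 2) := by
  rw [BlowupClass.vdim]
  simp only [quasiHomClass]
  rw [sum_quasiHomMult m₀ n m fun x : ℕ => ((x : ℤ) * (x + 1) / 2)]
  simp
  ring

end Classes

/-- Suppose F = A B with degrees a + b = f + 1. Multiplicity f at p₀ makes one factor, say A, have
its full degree a as multiplicity there, and B at least b - 1. By generality A passes through at
most a and B through at most 2b of the other points. This is too few, as a + 2b < 2(f + 1). -/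
theorem irreducible_of_monoid {f : ℕ} {p : Fin (2 * (f + 1) + 1) → PlanePoint K}
    (h1 : ∀ d ≤ f, NoCurveThrough p d d (d + 1))
    (h2 : ∀ d ≤ f, NoCurveThrough p d (d - 1) (2 * d + 1)) {F : MvPolynomial (Fin 3) K}
    (hF : F ∈ linearSystem (f + 1) (quasiHomMult f (2 * (f + 1)) 1) p) (hF0 : F ≠ 0) :
    Irreducible F := by
  classical
  have key : ∀ a b A B, a + b = f + 1 → 1 ≤ a → 1 ≤ b → A.IsHomogeneous a → B.IsHomogeneous b →
      A ≠ 0 → B ≠ 0 → F = A * B → ¬ HasMultGE A (p 0) a := by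
    intro a b A B hab ha hb hA hB hA0 hB0 heq hAa
    have hF0' : HasMultGE (A * B) (p 0) (a + (b - 1)) := by
      rw [← heq, show a + (b - 1) = f by omega]
      simpa [quasiHomMult] using hF.2 0
    have hBb := hF0'.of_mul fun h => hA0 (eq_zero_of_degree_lt_mult hA h (by omega))
    let T : MvPolynomial (Fin 3) K → Finset (Fin (2 * (f + 1) + 1)) := fun G =>
      (Finset.univ.erase 0).filter fun i => HasMultGE G (p i) 1
    have hT0 : ∀ G, (0 : Fin (2 * (f + 1) + 1)) ∉ T G := by simp [T]
    have hTG : ∀ G, ∀ i ∈ T G, HasMultGE G (p i) 1 := fun G i hi => (Finset.mem_filter.1 hi).2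
    have hA' := (h1 a (by omega)).card_lt (hT0 A) hA hA0 hAa (hTG A)
    have hB' := (h2 b (by omega)).card_lt (hT0 B) hB hB0 hBb (hTG B)
    have hsub : (Finset.univ.erase 0 : Finset (Fin (2 * (f + 1) + 1))) ⊆ T A ∪ T B := by
      intro i hi
      obtain ⟨j, rfl⟩ := Fin.exists_succ_eq.2 (Finset.ne_of_mem_erase hi)
      have hj : HasMultGE (A * B) (p j.succ) 1 := by
        rw [← heq]; simpa [quasiHomMult] using hF.2 j.succ
      rw [Finset.mem_union, Finset.mem_filter, Finset.mem_filter]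
      exact (hasMultGE_one_mul hj).imp (fun h => ⟨hi, h⟩) fun h => ⟨hi, h⟩
    have := (Finset.card_le_card hsub).trans (Finset.card_union_le _ _)
    rw [Finset.card_erase_of_mem (Finset.mem_univ _), Finset.card_fin] at this
    omega
  refine irreducible_of_forall hF.1 hF0 (by omega) ?_
  intro a b A B hab ha hb hA hB hA0 hB0 heq
  have h0 : HasMultGE (A * B) (p 0) ((a - 1) + (b - 1) + 1) := by
    rw [← heq, show a - 1 + (b - 1) + 1 = f by omega]
    simpa [quasiHomMult] using hF.2 0
  rcases hasMultGE_mul_dichotomy h0 with h | h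
  · rw [show a - 1 + 1 = a by omega] at h
    exact key a b A B hab ha hb hA hB hA0 hB0 heq h
  · rw [show b - 1 + 1 = b by omega] at h
    exact key b a B A (by omega) hb ha hB hA hB0 hA0 (by rw [heq, mul_comm]) h

variable [IsAlgClosed K] [CharZero K]

/-- The class of the line through `p₀` and `pᵢ`. -/
def lineClass (n : ℕ) (i : Fin n) : BlowupClass (n + 1) :=
  (1, Fin.cons 1 (Pi.single i 1))

variable (K) in
theorem isMinusOneCurve_lineClass (n : ℕ) (i : Fin n) : (lineClass n i).IsMinusOneCurve K := by
  refine ⟨?_, ?_, 1, Fin.cons 1 (Pi.single i 1), ?_, ?_⟩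
  · simp only [BlowupClass.inter, lineClass, Fin.sum_univ_succ, Fin.cons_zero, Fin.cons_succ]
    rw [Finset.sum_eq_single i] <;> simp +contextual
  · simp only [BlowupClass.genus, lineClass, Fin.sum_univ_succ, Fin.cons_zero, Fin.cons_succ]
    rw [Finset.sum_eq_zero]
    · norm_num
    · intro j _
      rcases eq_or_ne j i with rfl | h <;> simp [*]
  · refine Prod.ext (by simp [lineClass]) (funext fun j => ?_)
    refine Fin.cases (by simp [lineClass]) (fun j => ?_) j
    rcases eq_or_ne j i with rfl | h <;> simp [lineClass, *]
  -- `NoCurveThrough p 1 1 2` says that no three of the points are collinear.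
  · refine ((forGeneralPoints_injective _).and
      (forGeneralPoints_noCurveThrough _ 1 1 2 (by norm_num) (by decide))).mono ?_
    rintro p ⟨hp, hno⟩
    obtain ⟨F, hF, hF0⟩ := exists_mem_linearSystem_ne_zero (K := K) (d := 1)
      (m := Fin.cons 1 (Pi.single i 1)) (by
        rw [Fin.sum_univ_succ, Finset.sum_eq_single i]
        · simp
        · intro j _ hj; simp [hj]
        · simp) p
    refine ⟨F, hF, irreducible_of_forall hF.1 hF0 le_rfl (by omega), ?_⟩
    have hdeg : ∀ j, ¬ HasMultGE F (p j) 2 := fun j h =>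
      hF0 (eq_zero_of_degree_lt_mult hF.1 h (by norm_num))
    intro j
    refine Fin.cases (by simpa using hdeg 0) (fun j => ?_) j
    rcases eq_or_ne j i with rfl | h
    · simpa using hdeg j.succ
    · simp only [Fin.cons_succ, Pi.single_eq_of_ne h, zero_add]
      intro hj
      have h0 : HasMultGE F (p 0) 1 := by simpa using hF.2 0
      have hi : HasMultGE F (p i.succ) 1 := by simpa using hF.2 i.succ
      have := hno.card_lt (a := 0) (T := {i.succ, j.succ}) (by simp [Fin.ext_iff]) hF.1 hF0 h0
        (by simp [hi, hj])
      rw [Finset.card_pair (by simpa using h.symm)] at this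
      omega

variable (K) in
/-- Curves of degree `f + 1` with a point of multiplicity `f` through `2 (f + 1)` points. -/
theorem isMinusOneCurve_monoid (f : ℕ) :
    (quasiHomClass (f + 1) f (2 * (f + 1)) 1).IsMinusOneCurve K := by
  refine ⟨?_, ?_, f + 1, quasiHomMult f (2 * (f + 1)) 1, rfl, ?_⟩
  · rw [quasiHomClass_inter_quasiHomClass]; push_cast; ring
  · rw [quasiHomClass_genus]
    push_cast
    rw [show ((f : ℤ) + 1 - 1) * (f + 1 - 2) = f * (f - 1) by ring]
    simp
  -- Forms of degree d with multiplicity d, respectively d - 1, at a point form a space of dimension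
  -- d + 1, respectively 2d + 1 (for d = 0 the truncated d - 1 is harmless). The degrees run over a
  -- finite type because only finitely many general conditions can be combined.
  · have h1 : ForGeneralPoints K (2 * (f + 1) + 1) fun p =>
        ∀ d : Fin (f + 2), NoCurveThrough p d d (d + 1) :=
      forGeneralPoints_fintype fun d =>
        forGeneralPoints_noCurveThrough _ _ _ _ (by omega) (by
          rw [Nat.choose_succ_succ' (d + 1) 1]; simp; omega)
    have h2 : ForGeneralPoints K (2 * (f + 1) + 1) fun p =>
        ∀ d : Fin (f + 2), NoCurveThrough p d (d - 1) (2 * d + 1) :=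
      forGeneralPoints_fintype fun d =>
        forGeneralPoints_noCurveThrough _ _ _ _ (by omega) (by
          obtain ⟨d, hd⟩ := d
          rcases d with _ | d
          · simp
          · simp [Nat.choose_succ_succ' (d + 2) 1, Nat.choose_succ_succ' (d + 1) 1]; omega)
    refine ((forGeneralPoints_injective _).and (h1.and h2)).mono ?_
    rintro p ⟨hp, h1, h2⟩
    obtain ⟨F, hF, hF0⟩ := exists_mem_linearSystem_ne_zero (K := K) (d := f + 1)
      (m := quasiHomMult f (2 * (f + 1)) 1) (by
        rw [sum_quasiHomMult f _ 1 fun x => (x + 1).choose 2]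
        simp [Nat.choose_succ_succ' (f + 2) 1, Nat.choose_succ_succ' (f + 1) 1]; omega) p
    have hirr := irreducible_of_monoid (fun d hd => h1 ⟨d, by omega⟩)
      (fun d hd => h2 ⟨d, by omega⟩) hF hF0
    refine ⟨F, hF, hirr, ?_⟩
    have h0 : HasMultGE F (p 0) f := by simpa [quasiHomMult] using hF.2 0
    have hi : ∀ i : Fin (2 * (f + 1)), HasMultGE F (p i.succ) 1 := fun i => by
      simpa [quasiHomMult] using hF.2 i.succ
    intro i
    refine Fin.cases ?_ (fun i => ?_) i
    -- Multiplicity f + 1 at p₀ would allow at most f + 1 of the other 2(f + 1) points.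
    · rw [quasiHomMult, Fin.cons_zero]
      intro h
      have := (h1 ⟨f + 1, by omega⟩).card_lt (Finset.notMem_erase 0 Finset.univ) hF.1 hF0 h
        fun i hi' => by
          obtain ⟨j, rfl⟩ := Fin.exists_succ_eq.2 (Finset.ne_of_mem_erase hi')
          exact hi j
      rw [Finset.card_erase_of_mem (Finset.mem_univ _), Finset.card_fin] at this
      dsimp only at this
      omega
    -- With a double point at pᵢ, the line joining it to p₀ would meet F at least f + 2 times, so F
    -- would be a line, and a line has no double point.
    · rw [quasiHomMult, Fin.cons_succ]
      intro h
      have hd := degree_le_one_of_mult (fun h => (Fin.succ_ne_zero i).symm (hp h)) hF.1 hirr h0 h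
        (by omega)
      exact hF0 (eq_zero_of_degree_lt_mult hF.1 h (by omega))

variable (K) in
/-- The conic through five of six general points. -/
theorem isMinusOneCurve_conic : (quasiHomClass 2 0 5 1).IsMinusOneCurve K := by
  classical
  refine ⟨?_, ?_, 2, quasiHomMult 0 5 1, rfl, ?_⟩
  · rw [quasiHomClass_inter_quasiHomClass]; norm_num
  · rw [quasiHomClass_genus]; norm_num
  refine ((forGeneralPoints_injective _).and
    ((forGeneralPoints_noCurveThrough _ 1 1 2 (by norm_num) (by decide)).and
    (forGeneralPoints_noCurveThrough _ 2 1 5 (by norm_num) (by decide)))).mono ?_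
  rintro p ⟨hp, h1, h2⟩
  obtain ⟨F, hF, hF0⟩ := exists_mem_linearSystem_ne_zero (K := K) (d := 2)
    (m := quasiHomMult 0 5 1) (by decide) p
  have hi : ∀ i : Fin 5, HasMultGE F (p i.succ) 1 := fun i => by
    simpa [quasiHomMult] using hF.2 i.succ
  have hirr : Irreducible F := by
    refine irreducible_of_forall hF.1 hF0 (by omega) ?_
    intro a b A B hab ha hb hA hB hA0 hB0 heq
    obtain rfl : a = 1 := by omega
    obtain rfl : b = 1 := by omega
    let T : MvPolynomial (Fin 3) K → Finset (Fin 6) := fun G =>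
      (Finset.univ.erase 0).filter fun i => HasMultGE G (p i) 1
    -- No three points are collinear, so two lines cannot cover five points.
    have hcard : ∀ G : MvPolynomial (Fin 3) K, G.IsHomogeneous 1 → G ≠ 0 → (T G).card ≤ 2 := by
      intro G hG hG0
      by_contra! hlt
      obtain ⟨a, ha⟩ := Finset.card_pos.1 (by omega : 0 < (T G).card)
      have := h1.card_lt (Finset.notMem_erase a (T G)) hG hG0 (Finset.mem_filter.1 ha).2
        fun i hi => (Finset.mem_filter.1 (Finset.mem_of_mem_erase hi)).2
      rw [Finset.card_erase_of_mem ha] at this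
      omega
    have hsub : (Finset.univ.erase 0 : Finset (Fin 6)) ⊆ T A ∪ T B := by
      intro i hi'
      obtain ⟨j, rfl⟩ := Fin.exists_succ_eq.2 (Finset.ne_of_mem_erase hi')
      have hj : HasMultGE (A * B) (p j.succ) 1 := heq ▸ hi j
      rw [Finset.mem_union, Finset.mem_filter, Finset.mem_filter]
      exact (hasMultGE_one_mul hj).imp (fun h => ⟨hi', h⟩) fun h => ⟨hi', h⟩
    have := (Finset.card_le_card hsub).trans (Finset.card_union_le _ _)
    rw [Finset.card_erase_of_mem (Finset.mem_univ _), Finset.card_fin] at this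
    have := hcard A hA hA0
    have := hcard B hB hB0
    omega
  refine ⟨F, hF, hirr, fun i => ?_⟩
  refine Fin.cases ?_ (fun i => ?_) i
  · rw [quasiHomMult, Fin.cons_zero]
    intro h
    have := h2.card_lt (Finset.notMem_erase 0 Finset.univ) hF.1 hF0 h
      fun i hi' => by
        obtain ⟨j, rfl⟩ := Fin.exists_succ_eq.2 (Finset.ne_of_mem_erase hi')
        exact hi j
    rw [Finset.card_erase_of_mem (Finset.mem_univ _), Finset.card_fin] at this
    omega
  · rw [quasiHomMult, Fin.cons_succ]
    intro h
    obtain ⟨j, hj⟩ := exists_ne i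
    have := degree_le_one_of_mult (fun h => hj (Fin.succ_injective _ (hp h))) hF.1 hirr (hi j) h
      (by norm_num)
    omega

end Curves

/-! ### Intersection numbers, fixed components and dimensions. -/

section Intersection

namespace BlowupClass

variable {k : ℕ}

theorem inter_comm (A B : BlowupClass k) : A.inter B = B.inter A := by
  simp only [inter, mul_comm]

theorem inter_add_left (A B C : BlowupClass k) : (A + B).inter C = A.inter C + B.inter C := by
  simp only [inter, Prod.fst_add, Prod.snd_add, Pi.add_apply, add_mul, Finset.sum_add_distrib]
  ring

theorem inter_zsmul_left (c : ℤ) (A C : BlowupClass k) : (c • A).inter C = c * A.inter C := by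
  simp only [inter, Prod.smul_fst, Prod.smul_snd, Pi.smul_apply, smul_eq_mul, mul_sub,
    Finset.mul_sum, mul_assoc]

theorem inter_zero_left (C : BlowupClass k) : inter 0 C = 0 := by simp [inter]

theorem inter_sum_left {ι : Type*} (s : Finset ι) (f : ι → BlowupClass k) (C : BlowupClass k) :
    (∑ i ∈ s, f i).inter C = ∑ i ∈ s, (f i).inter C := by
  classical
  induction s using Finset.induction_on with
  | empty => simp [inter_zero_left]
  | insert a s ha ih => rw [Finset.sum_insert ha, Finset.sum_insert ha, inter_add_left, ih]

/-- The linear system of plane curves of a given class. -/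
noncomputable def system {K : Type*} [Field K] (L : BlowupClass k) (p : Fin k → PlanePoint K) :
    Submodule K (MvPolynomial (Fin 3) K) :=
  linearSystem L.1.toNat (fun i => (L.2 i).toNat) p

instance {K : Type*} [Field K] (L : BlowupClass k) (p : Fin k → PlanePoint K) :
    FiniteDimensional K (L.system p) := finiteDimensional_linearSystem _ _ _

/-- There is an irreducible curve with proper transform of class `A`. -/
def CurveAt {K : Type*} [Field K] (A : BlowupClass k) (p : Fin k → PlanePoint K)
    (F : MvPolynomial (Fin 3) K) : Prop :=
  F ∈ A.system p ∧ Irreducible F ∧ ∀ i, ¬ HasMultGE F (p i) ((A.2 i).toNat + 1)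

theorem two_mul_genus (A : BlowupClass k) :
    2 * A.genus = (A.1 - 1) * (A.1 - 2) - ∑ i, A.2 i * (A.2 i - 1) := by
  rw [genus, mul_sub, Finset.mul_sum, Int.two_mul_ediv_two_of_even]
  · congr 1
    refine Finset.sum_congr rfl fun i _ => Int.two_mul_ediv_two_of_even (Int.even_mul_pred_self _)
  · have := Int.even_mul_pred_self (A.1 - 1)
    rwa [show A.1 - 1 - 1 = A.1 - 2 by ring] at this

variable {K : Type*} [Field K]

theorem IsMinusOneCurve.nonneg {A : BlowupClass k} (h : A.IsMinusOneCurve K) : 0 ≤ A := by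
  obtain ⟨-, -, δ, μ, rfl, -⟩ := h
  exact ⟨Int.natCast_nonneg _, fun i => Int.natCast_nonneg _⟩

theorem IsMinusOneCurve.curveAt {A : BlowupClass k} (h : A.IsMinusOneCurve K) :
    ForGeneralPoints K k fun p => ∃ F, A.CurveAt p F := by
  obtain ⟨-, -, δ, μ, rfl, h⟩ := h
  refine h.mono fun p hp => ?_
  obtain ⟨F, h1, h2, h3⟩ := hp
  exact ⟨F, by simpa [system] using h1, h2, by simpa using h3⟩

theorem IsMinusOneCurve.one_le [Infinite K] {A : BlowupClass k} (h : A.IsMinusOneCurve K) :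
    1 ≤ A.1 := by
  obtain ⟨p, F, h1, h2, -⟩ := h.curveAt.exists
  have := degree_pos_of_irreducible h1.1 h2
  omega

theorem IsMinusOneCurve.le_degree [Infinite K] {A : BlowupClass k} (h : A.IsMinusOneCurve K)
    (i : Fin k) : A.2 i ≤ A.1 := by
  obtain ⟨p, F, h1, h2, -⟩ := h.curveAt.exists
  by_contra! hlt
  have h0 : 0 ≤ A.1 := h.nonneg.1
  exact h2.ne_zero (eq_zero_of_degree_lt_mult (m := (A.2 i).toNat) h1.1 (h1.2 i) (by omega))

/-- Riemann–Roch: v = A² + 1 - g, which is -1 + 1 - 0. -/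
theorem IsMinusOneCurve.vdim_eq {A : BlowupClass k} (h : A.IsMinusOneCurve K) : A.vdim = 0 := by
  obtain ⟨h1, h2, -⟩ := h
  have hv : 2 * A.vdim = A.1 * (A.1 + 3) - ∑ i, A.2 i * (A.2 i + 1) := by
    rw [vdim, mul_sub, Finset.mul_sum, Int.two_mul_ediv_two_of_even]
    · congr 1
      refine Finset.sum_congr rfl fun i _ => Int.two_mul_ediv_two_of_even (Int.even_mul_succ_self _)
    · have : A.1 * (A.1 + 3) = A.1 * (A.1 + 1) + 2 * A.1 := by ring
      rw [this]
      exact (Int.even_mul_succ_self _).add (even_two_mul _)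
  have hg := two_mul_genus A
  simp only [inter] at h1
  simp only [mul_add, mul_sub, Finset.sum_add_distrib, Finset.sum_sub_distrib, mul_one] at hv hg
  linarith

/-- Distinct `(-1)`-curves, one of them possibly on the blowup at fewer points, meet
non-negatively. -/
theorem inter_restrict_nonneg [Infinite K] [CharZero K] {k' : ℕ} {A : BlowupClass k'}
    {B : BlowupClass k} (hA : A.IsMinusOneCurve K) (hB : B.IsMinusOneCurve K) {f : Fin k → Fin k'}
    (hf : Function.Injective f) (hne : B ≠ (A.1, A.2 ∘ f)) :
    0 ≤ inter (A.1, A.2 ∘ f) B := by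
  obtain ⟨p, hp, ⟨F, hF, hFi, hFe⟩, G, hG, hGi, hGe⟩ :=
    ((forGeneralPoints_injective k').and (hA.curveAt.and (hB.curveAt.comp hf))).exists
  have hA1 : 0 ≤ A.1 := hA.nonneg.1
  have hA2 : ∀ i, 0 ≤ A.2 i := hA.nonneg.2
  have hB1 : 0 ≤ B.1 := hB.nonneg.1
  have hB2 : ∀ i, 0 ≤ B.2 i := hB.nonneg.2
  -- If F divides G, the two irreducible forms are associated. Their degrees and exact
  -- multiplicities then agree, against `hne`.
  by_cases hd : F ∣ G
  · have hd' : G ∣ F := (hFi.associated_of_dvd hGi hd).dvd'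
    refine absurd (Prod.ext ?_ (_root_.funext fun i => ?_)) hne
    · have h1 := degree_le_of_dvd hF.1 hG.1 hGi.ne_zero hd
      have h2 := degree_le_of_dvd hG.1 hF.1 hFi.ne_zero hd'
      dsimp only
      omega
    · have h1 : (A.2 (f i)).toNat ≤ (B.2 i).toNat := by
        by_contra! hlt
        exact hGe i (((hF.2 (f i)).of_dvd hd).mono hlt)
      have h2 : (B.2 i).toNat ≤ (A.2 (f i)).toNat := by
        by_contra! hlt
        exact hFe (f i) (((hG.2 i).of_dvd hd').mono hlt)
      have := hA2 (f i)
      have := hB2 i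
      simp only [Function.comp_apply]
      omega
  · have h1 : F ∈ linearSystem A.1.toNat (fun i => (A.2 (f i)).toNat) (p ∘ f) :=
      ⟨hF.1, fun i => hF.2 (f i)⟩
    have h2 := sum_mult_mul_le (hp.comp hf) h1 hG hFi hd
    zify at h2
    simp only [Int.toNat_of_nonneg, hA1, hA2, hB1, hB2] at h2
    simp only [inter, Function.comp_apply]
    linarith

theorem inter_nonneg [Infinite K] [CharZero K] {A B : BlowupClass k}
    (hA : A.IsMinusOneCurve K) (hB : B.IsMinusOneCurve K) (hne : A ≠ B) : 0 ≤ A.inter B :=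
  inter_restrict_nonneg hA hB (f := id) Function.injective_id hne.symm

theorem system_add_ge {L A : BlowupClass k} (hL : 0 ≤ L) (hA : 0 ≤ A) {p : Fin k → PlanePoint K}
    {F : MvPolynomial (Fin 3) K} (hF : F ∈ A.system p) (hF0 : F ≠ 0) :
    Module.finrank K (L.system p) ≤ Module.finrank K ((L + A).system p) := by
  have hinj : Function.Injective (LinearMap.mulLeft K F) := fun a b hab =>
    mul_left_cancel₀ hF0 hab
  rw [(Submodule.equivMapOfInjective _ hinj _).finrank_eq]
  refine Submodule.finrank_mono ?_
  rintro _ ⟨G, hG, rfl⟩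
  have := mul_mem_linearSystem hF hG
  change F * G ∈ _
  rw [system, Prod.fst_add, Prod.snd_add, Int.toNat_add hL.1 hA.1, add_comm]
  convert this using 2
  funext i
  rw [Pi.add_apply, Int.toNat_add (hL.2 i) (hA.2 i), Pi.add_apply, add_comm]

theorem dvd_of_inter_neg [CharZero K] {L A : BlowupClass k} (hL : 0 ≤ L) (hA : 0 ≤ A)
    {p : Fin k → PlanePoint K} (hp : Function.Injective p) {F G : MvPolynomial (Fin 3) K}
    (hF : A.CurveAt p F) (hG : G ∈ L.system p) (h : L.inter A < 0) : F ∣ G := by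
  by_contra hd
  have h2 := sum_mult_mul_le hp hF.1 hG hF.2.1 hd
  zify at h2
  have hA1 : 0 ≤ A.1 := hA.1
  have hA2 : ∀ i, 0 ≤ A.2 i := hA.2
  have hL1 : 0 ≤ L.1 := hL.1
  have hL2 : ∀ i, 0 ≤ L.2 i := hL.2
  simp only [Int.toNat_of_nonneg, hA1, hA2, hL1, hL2] at h2
  rw [inter_comm] at h
  simp only [inter] at h
  linarith

/-- A negative intersection makes F divide every member. Because F has exactly the multiplicities of
A, the quotient has those of L. -/
theorem system_add_le [CharZero K] {L A : BlowupClass k} (hL : 0 ≤ L) (hA : 0 ≤ A)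
    {p : Fin k → PlanePoint K} (hp : Function.Injective p) {F : MvPolynomial (Fin 3) K}
    (hF : A.CurveAt p F) (h : (L + A).inter A < 0) :
    Module.finrank K ((L + A).system p) ≤ Module.finrank K (L.system p) := by
  refine le_trans (Submodule.finrank_mono ?_)
    (Submodule.finrank_map_le (LinearMap.mulLeft K F) (L.system p))
  intro G hG
  obtain ⟨H, rfl⟩ := dvd_of_inter_neg (add_nonneg hL hA) hA hp hF hG h
  have hG' : F * H ∈ linearSystem (A.1.toNat + L.1.toNat)
      (fun i => (A.2 i).toNat + (L.2 i).toNat) p := by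
    rw [system, Prod.fst_add, Prod.snd_add, Int.toNat_add hL.1 hA.1, add_comm] at hG
    convert hG using 2
    funext i
    rw [Pi.add_apply, Int.toNat_add (hL.2 i) (hA.2 i), add_comm]
  refine ⟨H, ⟨?_, fun i => (hG'.2 i).of_mul (hF.2.2 i)⟩, rfl⟩
  rcases eq_or_ne H 0 with rfl | hH
  · exact isHomogeneous_zero _ _ _
  obtain ⟨a, b, hab, ha, hb⟩ := isHomogeneous_of_mul hG'.1 hF.2.1.ne_zero hH
  have := ha.inj_right hF.1.1 hF.2.1.ne_zero
  rwa [show b = L.1.toNat by omega] at hb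

theorem sum_nsmul_nonneg {S : Finset (BlowupClass k)} (hS : ∀ A ∈ S, 0 ≤ A)
    (N : BlowupClass k → ℕ) : 0 ≤ ∑ A ∈ S, N A • A :=
  Finset.sum_nonneg fun A hA => nsmul_nonneg (hS A hA) _

theorem inter_sum_nsmul {S : Finset (BlowupClass k)} {N : BlowupClass k → ℕ} {M A : BlowupClass k}
    (hdisj : ∀ B ∈ S, A ≠ B → B.inter A = 0) (hself : A.inter A = -1) (hM : M.inter A = 0) :
    (M + ∑ B ∈ S, N B • B).inter A = if A ∈ S then -(N A : ℤ) else 0 := by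
  classical
  rw [inter_add_left, hM, zero_add, inter_sum_left]
  have h : ∀ B, (N B • B).inter A = N B * B.inter A := fun B => by
    rw [← natCast_zsmul, inter_zsmul_left]
  simp only [h]
  split_ifs with hA
  · rw [Finset.sum_eq_single A]
    · rw [hself]; ring
    · intro B hB hne
      rw [hdisj B hB hne.symm, mul_zero]
    · exact fun h => absurd hA h
  · exact Finset.sum_eq_zero fun B hB => by
      rw [hdisj B hB (fun h => hA (h ▸ hB)), mul_zero]

/-- Pairwise disjoint `(-1)`-curves that do not meet `M` are fixed components of
`M + ∑ A, N A • A`. -/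
theorem finrank_system_add_sum_le [CharZero K] {S : Finset (BlowupClass k)} (N : BlowupClass k → ℕ)
    {M : BlowupClass k} (h0 : 0 ≤ M) (hS : ∀ A ∈ S, A.IsMinusOneCurve K)
    (hdisj : ∀ A ∈ S, ∀ B ∈ S, A ≠ B → B.inter A = 0) (hM : ∀ A ∈ S, M.inter A = 0)
    {p : Fin k → PlanePoint K} (hp : Function.Injective p) (hc : ∀ A ∈ S, ∃ F, A.CurveAt p F) :
    Module.finrank K ((M + ∑ A ∈ S, N A • A).system p) ≤ Module.finrank K (M.system p) := by
  classical
  induction S using Finset.induction_on with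
  | empty => rw [Finset.sum_empty, add_zero]
  | insert A S hA ih =>
    have ih := ih (fun B hB => hS B (Finset.mem_insert_of_mem hB))
      (fun B hB C hC => hdisj B (Finset.mem_insert_of_mem hB) C (Finset.mem_insert_of_mem hC))
      (fun B hB => hM B (Finset.mem_insert_of_mem hB))
      (fun B hB => hc B (Finset.mem_insert_of_mem hB))
    have hAS := Finset.mem_insert_self A S
    have hA1 := hS A hAS
    refine le_trans ?_ ih
    rw [Finset.sum_insert hA, add_comm (N A • A), ← add_assoc]
    set L := M + ∑ B ∈ S, N B • B with hLdef
    have hL0 : 0 ≤ L := add_nonneg h0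
      (sum_nsmul_nonneg (fun B hB => (hS B (Finset.mem_insert_of_mem hB)).nonneg) N)
    have hLA : L.inter A = 0 := by
      have := inter_sum_nsmul (N := N) (fun B hB hne =>
        hdisj A hAS B (Finset.mem_insert_of_mem hB) hne) hA1.1 (hM A hAS)
      rwa [if_neg hA] at this
    obtain ⟨F, hF⟩ := hc A hAS
    generalize N A = j
    induction j with
    | zero => rw [zero_nsmul, add_zero]
    | succ j ihj =>
      refine le_trans ?_ ihj
      rw [succ_nsmul, ← add_assoc]
      -- The class L + jA + A meets A in -(j + 1), since L·A = 0 and A² = -1.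
      refine system_add_le (add_nonneg hL0 (nsmul_nonneg hA1.nonneg _)) hA1.nonneg hp hF ?_
      rw [inter_add_left, inter_add_left, hLA, ← natCast_zsmul, inter_zsmul_left, hA1.1]
      omega

theorem vdim_add_one {M : BlowupClass k} (h0 : 0 ≤ M) : M.vdim + 1 =
    ((M.1.toNat + 2).choose 2 : ℕ) - ((∑ i, ((M.2 i).toNat + 1).choose 2 : ℕ) : ℤ) := by
  have h1 : ∀ a : ℕ, ((a + 1).choose 2 : ℤ) = (a : ℤ) * (a + 1) / 2 := by
    intro a
    rw [Nat.choose_two_right, Nat.add_sub_cancel, mul_comm]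
    push_cast
    rfl
  have hM1 : 0 ≤ M.1 := h0.1
  have hM2 : ∀ i, 0 ≤ M.2 i := h0.2
  rw [Nat.cast_sum]
  simp only [h1]
  rw [vdim]
  push_cast
  simp only [Int.toNat_of_nonneg, hM1, hM2]
  rw [show (M.1 + 1) * (M.1 + 1 + 1) = M.1 * (M.1 + 3) + 1 * 2 by ring,
    Int.add_mul_ediv_right _ _ two_ne_zero]
  ring

theorem vdim_lt_finrank_system [CharZero K] {M : BlowupClass k} (h0 : 0 ≤ M)
    (p : Fin k → PlanePoint K) : M.vdim + 1 ≤ Module.finrank K (M.system p) := by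
  rw [vdim_add_one h0]
  have := finrank_forms_le M.1.toNat (fun i => (M.2 i).toNat) p
  rw [system]
  omega

/-- Multiplying members of M by fixed members of the systems A embeds one system in the other. Each
A has virtual dimension 0, hence a nonzero member at every choice of points. No generality is
needed, as required for a minimum over all choices. -/
theorem vdim_le_finrank_system_add_sum [CharZero K] {S : Finset (BlowupClass k)}
    (N : BlowupClass k → ℕ) {M : BlowupClass k} (h0 : 0 ≤ M)
    (hS : ∀ A ∈ S, A.IsMinusOneCurve K) (p : Fin k → PlanePoint K) :
    M.vdim + 1 ≤ Module.finrank K ((M + ∑ A ∈ S, N A • A).system p) := by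
  classical
  refine (vdim_lt_finrank_system h0 p).trans ?_
  norm_cast
  induction S using Finset.induction_on with
  | empty => rw [Finset.sum_empty, add_zero]
  | insert A S hA ih =>
    refine (ih fun B hB => hS B (Finset.mem_insert_of_mem hB)).trans ?_
    have hA1 := hS A (Finset.mem_insert_self A S)
    rw [Finset.sum_insert hA, add_comm (N A • A), ← add_assoc]
    have hL0 : 0 ≤ M + ∑ B ∈ S, N B • B := add_nonneg h0
      (sum_nsmul_nonneg (fun B hB => (hS B (Finset.mem_insert_of_mem hB)).nonneg) N)
    obtain ⟨F, hF, hF0⟩ : ∃ F ∈ A.system p, F ≠ 0 := by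
      refine Submodule.exists_mem_ne_zero_of_ne_bot fun hbot => ?_
      have := vdim_lt_finrank_system hA1.nonneg p
      rw [hbot, finrank_bot, hA1.vdim_eq] at this
      norm_num at this
    generalize N A = j
    induction j with
    | zero => rw [zero_nsmul, add_zero]
    | succ j ihj =>
      rw [succ_nsmul, ← add_assoc]
      exact ihj.trans (system_add_ge (add_nonneg hL0 (nsmul_nonneg hA1.nonneg _)) hA1.nonneg hF hF0)

/-- `M` has the expected dimension at general points, in the form of an upper bound. The points may
be part of a larger set of general points. -/
def HasExpectedDim (K : Type*) [Field K] (M : BlowupClass k) : Prop :=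
  ∃ (k' : ℕ) (f : Fin k → Fin k'), Function.Injective f ∧ ForGeneralPoints K k' fun p =>
    (Module.finrank K (M.system (p ∘ f)) : ℤ) ≤ M.vdim + 1

theorem finrank_system_zero_le (p : Fin k → PlanePoint K) :
    Module.finrank K (system 0 p) ≤ 1 := by
  have h := Submodule.finrank_mono (linearSystem_le 0 (fun i => ((0 : BlowupClass k).2 i).toNat) p)
  rw [finrank_forms] at h
  exact h

/-- A (-1)-curve is the only member of its system. Forgetting simple points raises the virtual
dimension by their number and the actual dimension by at most that. -/
theorem hasExpectedDim_restrict [Infinite K] [CharZero K] {k' : ℕ} {C : BlowupClass k'}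
    (hC : C.IsMinusOneCurve K) {f : Fin k → Fin k'} (hf : Function.Injective f)
    (h1 : ∀ x, x ∉ Set.range f → C.2 x = 1) : HasExpectedDim K (C.1, C.2 ∘ f) := by
  classical
  refine ⟨k', f, hf, ((forGeneralPoints_injective k').and hC.curveAt).mono ?_⟩
  rintro p ⟨hp, F, hF⟩
  set M : BlowupClass k := (C.1, C.2 ∘ f)
  let E : Finset (Fin k') := Finset.univ \ Finset.univ.image f
  have hE : ∀ x, x ∈ E ↔ x ∉ Set.range f := by simp [E]
  have hvdim : M.vdim = E.card := by
    have h0 : C.vdim = 0 := hC.vdim_eq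
    rw [vdim] at h0 ⊢
    rw [← Finset.sum_sdiff (Finset.subset_univ (Finset.univ.image f)),
      Finset.sum_image (fun a _ b _ hab => hf hab),
      Finset.sum_congr rfl fun x hx => by rw [h1 x ((hE x).1 hx)]] at h0
    simp only [Finset.sum_const, nsmul_eq_mul] at h0
    simp only [M, Function.comp_apply]
    norm_num at h0
    linarith
  let g : M.system (p ∘ f) →ₗ[K] (E → K) := LinearMap.pi fun x =>
    (aeval (p x).rep : MvPolynomial (Fin 3) K →ₐ[K] K).toLinearMap ∘ₗ
      (M.system (p ∘ f)).subtype
  have hker : ∀ G ∈ LinearMap.ker g, (G : MvPolynomial (Fin 3) K) ∈ C.system p := by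
    intro G hG
    refine ⟨G.2.1, fun x => ?_⟩
    by_cases hx : x ∈ Set.range f
    · obtain ⟨i, rfl⟩ := hx
      exact G.2.2 i
    · dsimp only
      rw [h1 x hx, Int.toNat_one, hasMultGE_one_iff]
      have := congrFun (LinearMap.mem_ker.1 hG) ⟨x, (hE x).2 hx⟩
      simpa [g, aeval_eq_eval] using this
  -- Since C² = -1, the curve splits off its own class and leaves the constants.
  have hle : Module.finrank K (LinearMap.ker g) ≤ 1 := by
    have h2 : Module.finrank K (C.system p) ≤ 1 := by
      have := system_add_le le_rfl hC.nonneg hp hF (by rw [zero_add, hC.1]; norm_num)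
      rw [zero_add] at this
      exact this.trans (finrank_system_zero_le p)
    refine le_trans ?_ h2
    let φ : LinearMap.ker g →ₗ[K] C.system p :=
      LinearMap.codRestrict _ ((M.system (p ∘ f)).subtype ∘ₗ (LinearMap.ker g).subtype)
        fun x => hker x.1 x.2
    refine LinearMap.finrank_le_finrank_of_injective (f := φ) fun x y hxy => ?_
    have h : (x.1 : MvPolynomial (Fin 3) K) = y.1 :=
      congrArg (fun z : C.system p => (z : MvPolynomial (Fin 3) K)) hxy
    exact Subtype.ext (Subtype.ext h)
  have hr := g.finrank_range_add_finrank_ker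
  have hr2 := Submodule.finrank_le (LinearMap.range g)
  rw [Module.finrank_fintype_fun_eq_card, Fintype.card_coe] at hr2
  rw [hvdim]
  omega

/-- The class of `a` lines through `p₀`. -/
theorem hasExpectedDim_pencil (a n : ℕ) : HasExpectedDim K (quasiHomClass a a n 0) := by
  refine ⟨n + 1, id, Function.injective_id, (forGeneralPoints_injective _).mono fun p hp => ?_⟩
  have h0 : (0 : BlowupClass (n + 1)) ≤ quasiHomClass a a n 0 :=
    ⟨Int.natCast_nonneg _, fun i => Int.natCast_nonneg _⟩
  rw [vdim_add_one h0]
  have := finrank_linearSystem_le (p := p) hp a (quasiHomMult a n 0) (by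
    rw [sum_quasiHomMult a n 0 fun x => x]; simp)
  simp only [system, quasiHomClass, Int.toNat_natCast, Function.comp_id]
  change (Module.finrank K (linearSystem a (quasiHomMult a n 0) p) : ℤ) ≤ _
  omega

/-- The value M.vdim is a lower bound at every choice of points. It is attained at a general one,
where the curves of S split off and M has the expected dimension. -/
theorem genericDim_eq [Infinite K] [CharZero K] {d : ℕ} {m : Fin k → ℕ}
    {S : Finset (BlowupClass k)} (N : BlowupClass k → ℕ)
    {M : BlowupClass k} (h0 : 0 ≤ M) (hS : ∀ A ∈ S, A.IsMinusOneCurve K)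
    (hdisj : ∀ A ∈ S, ∀ B ∈ S, A ≠ B → B.inter A = 0) (hM : ∀ A ∈ S, M.inter A = 0)
    (hdim : M.HasExpectedDim K)
    (hL : ((d : ℤ), fun i => (m i : ℤ)) = M + ∑ A ∈ S, N A • A) : genericDim K d m = M.vdim := by
  have hsys : ∀ p : Fin k → PlanePoint K,
      linearSystem d m p = (M + ∑ A ∈ S, N A • A).system p := by
    intro p
    rw [← hL]
    simp [system]
  have hlow : ∀ p : Fin k → PlanePoint K, M.vdim + 1 ≤ Module.finrank K (linearSystem d m p) := by
    intro p
    rw [hsys]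
    exact vdim_le_finrank_system_add_sum N h0 hS p
  obtain ⟨k', f, hf, hgen⟩ := hdim
  obtain ⟨p, ⟨hp, hc⟩, hle⟩ := ((((forGeneralPoints_injective k).and (forGeneralPoints_finset S
    fun A hA => (hS A hA).curveAt)).comp hf).and hgen).exists
  have hup : (Module.finrank K (linearSystem d m (p ∘ f)) : ℤ) ≤ M.vdim + 1 := by
    rw [hsys]
    refine le_trans ?_ hle
    exact_mod_cast finrank_system_add_sum_le N h0 hS hdisj hM hp hc
  have hnonempty : Nonempty (Fin k → PlanePoint K) := ⟨p ∘ f⟩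
  have h1 : (⨅ q : Fin k → PlanePoint K, Module.finrank K (linearSystem d m q)) ≤ _ :=
    ciInf_le (OrderBot.bddBelow _) (p ∘ f)
  obtain ⟨q, hq⟩ := Nat.sInf_mem
    (Set.range_nonempty fun q : Fin k → PlanePoint K => Module.finrank K (linearSystem d m q))
  have h2 : Module.finrank K (linearSystem d m q)
      = ⨅ q : Fin k → PlanePoint K, Module.finrank K (linearSystem d m q) := hq
  have := hlow q
  rw [genericDim]
  omega

/-- Disjointness and A² = -1 give -L·A = N A, so the residual of L for S is exactly M. -/
theorem isMinusOneSpecial_of_decomposition {L : BlowupClass k}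
    {S : Finset (BlowupClass k)} (N : BlowupClass k → ℕ)
    {M : BlowupClass k} (h0 : 0 ≤ M) (hS : ∀ A ∈ S, A.IsMinusOneCurve K)
    (hdisj : ∀ A ∈ S, ∀ B ∈ S, A ≠ B → B.inter A = 0) (hM : ∀ A ∈ S, M.inter A = 0)
    (hv : 0 ≤ M.vdim) (hnef : ∀ B : BlowupClass k, B.IsMinusOneCurve K → 0 ≤ M.inter B)
    (hN1 : ∀ A ∈ S, 1 ≤ N A) (hN2 : ∃ A ∈ S, 2 ≤ N A)
    (hL : L = M + ∑ A ∈ S, N A • A) : L.IsMinusOneSpecial K := by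
  have hi : ∀ A ∈ S, -(L.inter A) = N A := by
    intro A hA
    rw [hL, inter_sum_nsmul (hdisj A hA) (hS A hA).1 (hM A hA), if_pos hA, neg_neg]
  have hres : L.residual S = M := by
    rw [residual, Finset.sum_congr rfl fun A hA => by rw [hi A hA, natCast_zsmul], hL,
      add_sub_cancel_right]
  refine ⟨S, fun A hA => ⟨hS A hA, ?_⟩, ?_, ?_, ?_, ?_⟩
  · rw [hi A hA]; exact_mod_cast hN1 A hA
  · obtain ⟨A, hA, h⟩ := hN2
    exact ⟨A, hA, by rw [hi A hA]; exact_mod_cast h⟩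
  · rw [hres]; exact h0.1
  · rwa [hres]
  · rwa [hres]

end BlowupClass

end Intersection

/-! ### Decompositions of the listed systems. -/

section Rows

open BlowupClass

variable {K : Type*} [Field K] [IsAlgClosed K] [CharZero K]

theorem quasiHomClass_nonneg (d m₀ n m : ℕ) : 0 ≤ quasiHomClass d m₀ n m :=
  ⟨Int.natCast_nonneg _, fun _ => Int.natCast_nonneg _⟩

theorem quasiHomClass_snd_zero (d m₀ n m : ℕ) : (quasiHomClass d m₀ n m).2 0 = m₀ := rfl

theorem quasiHomClass_snd_succ (d m₀ n m : ℕ) (i : Fin n) :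
    (quasiHomClass d m₀ n m).2 i.succ = m := rfl

theorem BlowupClass.ext_succ {n : ℕ} {A B : BlowupClass (n + 1)} (h1 : A.1 = B.1)
    (h2 : A.2 0 = B.2 0) (h3 : ∀ i : Fin n, A.2 i.succ = B.2 i.succ) : A = B :=
  Prod.ext h1 (_root_.funext fun i => Fin.cases h2 h3 i)

theorem quasiHomClass_vdim_eq {d m₀ n m : ℕ} {v : ℤ}
    (h : (d : ℤ) * (d + 3) - m₀ * (m₀ + 1) - n * (m * (m + 1)) = 2 * v) :
    (quasiHomClass d m₀ n m).vdim = v := by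
  rw [quasiHomClass_vdim]
  have h1 : 2 * ((d : ℤ) * (d + 3) / 2) = d * (d + 3) := by
    refine Int.two_mul_ediv_two_of_even ?_
    rw [show (d : ℤ) * (d + 3) = d * (d + 1) + 2 * d by ring]
    exact (Int.even_mul_succ_self _).add (even_two_mul _)
  have h2 := Int.two_mul_ediv_two_of_even (Int.even_mul_succ_self (m₀ : ℤ))
  have h3 := Int.two_mul_ediv_two_of_even (Int.even_mul_succ_self (m : ℤ))
  have h4 : (n : ℤ) * (m * (m + 1)) = 2 * (n * (m * (m + 1) / 2)) := by
    rw [mul_left_comm 2, h3]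
  omega

theorem lineClass_fst (n : ℕ) (i : Fin n) : (lineClass n i).1 = 1 := rfl

theorem lineClass_snd_zero (n : ℕ) (i : Fin n) : (lineClass n i).2 0 = 1 := rfl

theorem lineClass_snd_succ (n : ℕ) (i j : Fin n) :
    (lineClass n i).2 j.succ = if j = i then 1 else 0 := by
  simp [lineClass, Pi.single_apply]

theorem lineClass_injective (n : ℕ) : Function.Injective (lineClass n) := by
  intro i j h
  by_contra hne
  have := lineClass_snd_succ n j i
  rw [← h, lineClass_snd_succ] at this
  simp [hne] at this

/-- The classes of the lines through `p₀` and another point. -/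
def lineClasses (n : ℕ) : Finset (BlowupClass (n + 1)) :=
  Finset.univ.map ⟨lineClass n, lineClass_injective n⟩

theorem mem_lineClasses {n : ℕ} {A : BlowupClass (n + 1)} :
    A ∈ lineClasses n ↔ ∃ i, lineClass n i = A := by
  simp [lineClasses]

theorem inter_lineClass {n : ℕ} (A : BlowupClass (n + 1)) (i : Fin n) :
    A.inter (lineClass n i) = A.1 - A.2 0 - A.2 i.succ := by
  simp only [inter, Fin.sum_univ_succ, lineClass_fst, lineClass_snd_zero, lineClass_snd_succ,
    mul_one, mul_ite, mul_zero]
  rw [Finset.sum_ite_eq' Finset.univ i]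
  simp
  ring

theorem sum_lineClasses (n N : ℕ) :
    ∑ A ∈ lineClasses n, N • A = quasiHomClass (N * n) (N * n) n N := by
  rw [lineClasses, Finset.sum_map]
  refine BlowupClass.ext_succ ?_ ?_ fun i => ?_
  · simp [Prod.fst_sum, lineClass_fst, quasiHomClass, mul_comm]
  · simp [Prod.snd_sum, lineClass_snd_zero, quasiHomClass_snd_zero, mul_comm]
  · simp [Prod.snd_sum, lineClass_snd_succ, quasiHomClass_snd_succ]

theorem inter_eq_zero_of_mem_lineClasses {n : ℕ} {A B : BlowupClass (n + 1)}
    (hA : A ∈ lineClasses n) (hB : B ∈ lineClasses n) (hne : A ≠ B) : B.inter A = 0 := by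
  obtain ⟨i, rfl⟩ := mem_lineClasses.1 hA
  obtain ⟨j, rfl⟩ := mem_lineClasses.1 hB
  have hij : i ≠ j := fun h => hne (h ▸ rfl)
  rw [inter_lineClass, lineClass_fst, lineClass_snd_zero, lineClass_snd_succ, if_neg hij]
  norm_num

/-- Effective classes of expected dimension that meet every `(-1)`-curve non-negatively. -/
structure IsGoodResidual (K : Type*) [Field K] {k : ℕ} (M : BlowupClass k) : Prop where
  nonneg : 0 ≤ M
  vdim_nonneg : 0 ≤ M.vdim
  inter_nonneg : ∀ B : BlowupClass k, B.IsMinusOneCurve K → 0 ≤ M.inter B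
  hasExpectedDim : M.HasExpectedDim K

theorem quasiHomClass_pencil_vdim (a n : ℕ) : (quasiHomClass a a n 0).vdim = a :=
  quasiHomClass_vdim_eq (by push_cast; ring)

theorem isGoodResidual_pencil (K : Type*) [Field K] [Infinite K] (a n : ℕ) : IsGoodResidual K (quasiHomClass a a n 0) where
  nonneg := quasiHomClass_nonneg _ _ _ _
  vdim_nonneg := by rw [quasiHomClass_pencil_vdim]; exact Int.natCast_nonneg _
  inter_nonneg B hB := by
    rw [quasiHomClass_inter]
    have := mul_nonneg (Int.natCast_nonneg a) (sub_nonneg.2 (hB.le_degree 0))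
    push_cast
    linarith
  hasExpectedDim := hasExpectedDim_pencil a n

theorem quasiHomClass_comp_castLE {d m₀ n n' m : ℕ} (h : n ≤ n') :
    ((quasiHomClass d m₀ n' m).1, (quasiHomClass d m₀ n' m).2 ∘ Fin.castLE (Nat.succ_le_succ h)) =
      quasiHomClass d m₀ n m :=
  BlowupClass.ext_succ rfl rfl fun _ => rfl

/-- Dropping simple points from a (-1)-curve C keeps its intersections with the (-1)-curves on the
smaller blowup non-negative, because C itself is a curve different from each of them. -/
theorem isGoodResidual_restrict {d m₀ n n' : ℕ} (h : n < n')
    (hC : (quasiHomClass d m₀ n' 1).IsMinusOneCurve K) (hv : 0 ≤ (quasiHomClass d m₀ n 1).vdim) :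
    IsGoodResidual K (quasiHomClass d m₀ n 1) := by
  refine ⟨quasiHomClass_nonneg _ _ _ _, hv, fun B hB => ?_, ?_⟩
  · rw [← quasiHomClass_comp_castLE h.le]
    refine inter_restrict_nonneg hC hB (Fin.castLE_injective _) ?_
    rw [quasiHomClass_comp_castLE h.le]
    rintro rfl
    -- Dropping n' - n > 0 simple points raises the self-intersection above -1, so the new class is
    -- not that of a (-1)-curve.
    have h1 := hC.1
    have h2 := hB.1
    rw [quasiHomClass_inter_quasiHomClass] at h1 h2
    push_cast at h1 h2
    omega
  · rw [← quasiHomClass_comp_castLE h.le]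
    refine hasExpectedDim_restrict hC (Fin.castLE_injective _) fun x hx => ?_
    refine Fin.cases (fun hx => ?_) (fun i _ => rfl) x hx
    exact absurd ⟨0, rfl⟩ hx

theorem quasiHomClass_monoid_vdim (f e : ℕ) :
    (quasiHomClass (f + 1) f e 1).vdim = 2 * (f + 1) - e :=
  quasiHomClass_vdim_eq (by push_cast; ring)

variable (K) in
theorem isGoodResidual_monoid {f e : ℕ} (h : e < 2 * (f + 1)) :
    IsGoodResidual K (quasiHomClass (f + 1) f e 1) :=
  isGoodResidual_restrict h (isMinusOneCurve_monoid K f) (by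
    rw [quasiHomClass_monoid_vdim]; omega)

theorem quasiHomClass_conic_vdim (e : ℕ) : (quasiHomClass 2 0 e 1).vdim = 5 - e :=
  quasiHomClass_vdim_eq (by push_cast; ring)

variable (K) in
theorem isGoodResidual_conic {e : ℕ} (h : e < 5) : IsGoodResidual K (quasiHomClass 2 0 e 1) :=
  isGoodResidual_restrict h (isMinusOneCurve_conic K) (by
    rw [quasiHomClass_conic_vdim]; omega)

theorem isMinusOneSpecial_and_genericDim {d m₀ n m : ℕ} {S : Finset (BlowupClass (n + 1))}
    (N : BlowupClass (n + 1) → ℕ) {M : BlowupClass (n + 1)} (hgood : IsGoodResidual K M)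
    (hS : ∀ A ∈ S, A.IsMinusOneCurve K)
    (hdisj : ∀ A ∈ S, ∀ B ∈ S, A ≠ B → B.inter A = 0) (hM : ∀ A ∈ S, M.inter A = 0)
    (hN1 : ∀ A ∈ S, 1 ≤ N A) (hN2 : ∃ A ∈ S, 2 ≤ N A)
    (hL : quasiHomClass d m₀ n m = M + ∑ A ∈ S, N A • A) :
    (quasiHomClass d m₀ n m).IsMinusOneSpecial K ∧
      genericDim K d (quasiHomMult m₀ n m) = M.vdim := by
  exact ⟨isMinusOneSpecial_of_decomposition N hgood.1 hS hdisj hM hgood.2 hgood.3 hN1 hN2 hL,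
    genericDim_eq N hgood.1 hS hdisj hM hgood.4 hL⟩

theorem special_add_curve {a b n c δ μ : ℕ} (N : ℕ) (hN : 2 ≤ N)
    (hgood : IsGoodResidual K (quasiHomClass a b n c))
    (hA : (quasiHomClass δ μ n 1).IsMinusOneCurve K)
    (hMA : (a : ℤ) * δ - b * μ - n * c * (1 : ℕ) = 0) :
    (quasiHomClass (a + N * δ) (b + N * μ) n (c + N)).IsMinusOneSpecial K ∧
      genericDim K (a + N * δ) (quasiHomMult (b + N * μ) n (c + N)) =
        (quasiHomClass a b n c).vdim := by
  refine isMinusOneSpecial_and_genericDim (S := {quasiHomClass δ μ n 1}) (fun _ => N) hgood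
    ?_ ?_ ?_ ?_ ?_ ?_
  · simpa using hA
  · simp
  · simpa [quasiHomClass_inter_quasiHomClass] using hMA
  · intro _ _; omega
  · exact ⟨_, Finset.mem_singleton_self _, hN⟩
  · rw [Finset.sum_singleton]
    refine BlowupClass.ext_succ ?_ ?_ fun i => ?_
    · simp [quasiHomClass]
    · simp [quasiHomClass_snd_zero]
    · simp [quasiHomClass_snd_succ]

/-- The degree b + c makes the residual (b + c; b, cⁿ) disjoint from all n lines through p₀. -/
theorem special_add_lines {b n c : ℕ} (N : ℕ) (hN : 2 ≤ N) (hn : 1 ≤ n)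
    (hgood : IsGoodResidual K (quasiHomClass (b + c) b n c)) :
    (quasiHomClass (b + c + N * n) (b + N * n) n (c + N)).IsMinusOneSpecial K ∧
      genericDim K (b + c + N * n) (quasiHomMult (b + N * n) n (c + N)) =
        (quasiHomClass (b + c) b n c).vdim := by
  refine isMinusOneSpecial_and_genericDim (S := lineClasses n) (fun _ => N) hgood
    ?_ ?_ ?_ ?_ ?_ ?_
  · intro A hA
    obtain ⟨i, rfl⟩ := mem_lineClasses.1 hA
    exact isMinusOneCurve_lineClass K n i
  · exact fun A hA B hB => inter_eq_zero_of_mem_lineClasses hA hB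
  · intro A hA
    obtain ⟨i, rfl⟩ := mem_lineClasses.1 hA
    rw [inter_lineClass, quasiHomClass_snd_zero, quasiHomClass_snd_succ]
    simp [quasiHomClass]
  · intro _ _; omega
  · exact ⟨lineClass n ⟨0, hn⟩, mem_lineClasses.2 ⟨_, rfl⟩, hN⟩
  · rw [sum_lineClasses]
    refine BlowupClass.ext_succ ?_ ?_ fun i => ?_
    · simp [quasiHomClass]
    · simp [quasiHomClass_snd_zero]
    · simp [quasiHomClass_snd_succ]

/-- The monoidal curve is disjoint from each of the lines, so both can be fixed parts at once, with
residual 0. -/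
theorem special_monoid_add_lines {f : ℕ} (N₁ N₂ : ℕ) (h1 : 1 ≤ N₁) (h2 : 1 ≤ N₂)
    (h3 : 2 ≤ N₁ ∨ 2 ≤ N₂) {d m₀ n m : ℕ} (hd : d = N₁ * (f + 1) + N₂ * n)
    (hm₀ : m₀ = N₁ * f + N₂ * n) (hn : n = 2 * (f + 1)) (hm : m = N₁ + N₂) :
    (quasiHomClass d m₀ n m).IsMinusOneSpecial K ∧ genericDim K d (quasiHomMult m₀ n m) = 0 := by
  classical
  subst hd hm₀ hm
  set A := quasiHomClass (f + 1) f n 1 with hAdef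
  have hA : A.IsMinusOneCurve K := by
    rw [hAdef, hn]; exact isMinusOneCurve_monoid K f
  have hAl : ∀ i, A.inter (lineClass n i) = 0 := by
    intro i
    rw [inter_lineClass, quasiHomClass_snd_zero, quasiHomClass_snd_succ]
    simp [A, quasiHomClass]
  have hAn : A ∉ lineClasses n := by
    intro h
    obtain ⟨i, hi⟩ := mem_lineClasses.1 h
    have := hAl i
    rw [hi, hA.1] at this
    norm_num at this
  have hz : quasiHomClass 0 0 n 0 = 0 := BlowupClass.ext_succ rfl rfl fun _ => rfl
  rw [show (0 : ℤ) = (quasiHomClass 0 0 n 0).vdim by rw [quasiHomClass_pencil_vdim]; rfl]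
  refine isMinusOneSpecial_and_genericDim (S := insert A (lineClasses n))
    (fun B => if B = A then N₁ else N₂) (isGoodResidual_pencil K 0 n) ?_ ?_ ?_ ?_ ?_ ?_
  · intro B hB
    rcases Finset.mem_insert.1 hB with rfl | hB
    · exact hA
    · obtain ⟨i, rfl⟩ := mem_lineClasses.1 hB
      exact isMinusOneCurve_lineClass K n i
  · intro B hB C hC hne
    rcases Finset.mem_insert.1 hB with rfl | hB <;> rcases Finset.mem_insert.1 hC with rfl | hC
    · exact absurd rfl hne
    · obtain ⟨i, rfl⟩ := mem_lineClasses.1 hC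
      rw [inter_comm]; exact hAl i
    · obtain ⟨i, rfl⟩ := mem_lineClasses.1 hB
      exact hAl i
    · exact inter_eq_zero_of_mem_lineClasses hB hC hne
  · intro B _
    rw [hz, inter_zero_left]
  · intro B _
    split_ifs <;> assumption
  · rcases h3 with h3 | h3
    · exact ⟨A, Finset.mem_insert_self _ _, by simpa using h3⟩
    · have hl : lineClass n ⟨0, by omega⟩ ∈ lineClasses n := mem_lineClasses.2 ⟨_, rfl⟩
      refine ⟨_, Finset.mem_insert_of_mem hl, ?_⟩
      rw [if_neg (ne_of_mem_of_not_mem hl hAn)]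
      exact h3
  · rw [Finset.sum_insert hAn, if_pos rfl, Finset.sum_congr (g := fun B => N₂ • B) rfl
      fun B hB => by rw [if_neg (ne_of_mem_of_not_mem hB hAn)], sum_lineClasses, hz, zero_add]
    refine BlowupClass.ext_succ ?_ ?_ fun i => ?_
    · simp [A, quasiHomClass]
    · simp [A, quasiHomClass_snd_zero]
    · simp [A, quasiHomClass_snd_succ]

variable (K) in
theorem ListedSystem.special_and_dim {d m₀ n m : ℕ} {v l : ℤ} (h : ListedSystem d m₀ n m v l) :
    (quasiHomClass d m₀ n m).IsMinusOneSpecial K ∧ (quasiHomClass d m₀ n m).vdim = v ∧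
      genericDim K d (quasiHomMult m₀ n m) = l := by
  induction h with
  | row1 =>
    obtain ⟨h1, h2⟩ := special_add_curve 2 le_rfl (isGoodResidual_pencil K 0 5)
      (isMinusOneCurve_conic K) (by simp)
    rw [quasiHomClass_pencil_vdim] at h2
    exact ⟨h1, quasiHomClass_vdim_eq (by norm_num), h2⟩
  | row2 e he =>
    obtain ⟨f, rfl⟩ : ∃ f, e = f + 1 := ⟨e - 1, by omega⟩
    obtain ⟨h1, h2⟩ := special_add_curve 2 le_rfl (isGoodResidual_pencil K 0 _)
      (isMinusOneCurve_monoid K f) (by simp)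
    rw [quasiHomClass_pencil_vdim] at h2
    simp only [zero_add] at h1 h2
    rw [show 2 * (f + 1) - 2 = 2 * f by omega]
    exact ⟨h1, quasiHomClass_vdim_eq (by push_cast; ring), h2⟩
  | row3 d e hd he =>
    obtain ⟨a, rfl⟩ : ∃ a, d = a + 2 * e := ⟨d - 2 * e, by omega⟩
    obtain ⟨h1, h2⟩ := special_add_lines (b := a) (n := e) (c := 0) 2 le_rfl (by omega)
      (isGoodResidual_pencil K a e)
    rw [add_zero, quasiHomClass_pencil_vdim] at h2
    simp only [zero_add, add_zero] at h1 h2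
    exact ⟨h1, quasiHomClass_vdim_eq (by push_cast; ring), by rw [h2]; push_cast; ring⟩
  | row4 =>
    -- (4; 0, 3²) = (2; 0, 1²) + 2 (1; 0, 1²): the monoid with f = 0 is the line through p₁ and p₂.
    obtain ⟨h1, h2⟩ := special_add_curve 2 le_rfl (isGoodResidual_conic K (e := 2) (by norm_num))
      (isMinusOneCurve_monoid K 0) (by norm_num)
    rw [quasiHomClass_conic_vdim] at h2
    exact ⟨h1, quasiHomClass_vdim_eq (by norm_num), by simpa using h2⟩
  | row5 =>
    obtain ⟨h1, h2⟩ := special_add_curve 3 (by norm_num) (isGoodResidual_pencil K 0 5)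
      (isMinusOneCurve_conic K) (by simp)
    rw [quasiHomClass_pencil_vdim] at h2
    exact ⟨h1, quasiHomClass_vdim_eq (by norm_num), h2⟩
  | row6 =>
    -- (6; 2, 3⁴) = (2; 0, 1⁴) + 2 (2; 1, 1⁴).
    obtain ⟨h1, h2⟩ := special_add_curve 2 le_rfl (isGoodResidual_conic K (e := 4) (by norm_num))
      (isMinusOneCurve_monoid K 1) (by norm_num)
    rw [quasiHomClass_conic_vdim] at h2
    exact ⟨h1, quasiHomClass_vdim_eq (by norm_num), by simpa using h2⟩
  | row7 e he =>
    obtain ⟨f, rfl⟩ : ∃ f, e = f + 1 := ⟨e - 1, by omega⟩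
    obtain ⟨h1, h2⟩ := special_add_curve 3 (by norm_num) (isGoodResidual_pencil K 0 _)
      (isMinusOneCurve_monoid K f) (by simp)
    rw [quasiHomClass_pencil_vdim] at h2
    simp only [zero_add] at h1 h2
    rw [show 3 * (f + 1) - 3 = 3 * f by omega]
    exact ⟨h1, quasiHomClass_vdim_eq (by push_cast; ring), h2⟩
  | row8 e he =>
    obtain ⟨f, rfl⟩ : ∃ f, e = f + 1 := ⟨e - 1, by omega⟩
    -- The residual is the monoidal class (e + 1; e, 1^{2e}), two simple points short of a
    -- (-1)-curve.
    obtain ⟨h1, h2⟩ := special_add_curve 2 le_rfl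
      (isGoodResidual_monoid K (f := f + 1) (e := 2 * (f + 1)) (by omega))
      (isMinusOneCurve_monoid K f) (by push_cast; ring)
    rw [quasiHomClass_monoid_vdim] at h2
    rw [show f + 1 + 1 + 2 * (f + 1) = 3 * (f + 1) + 1 by ring,
      show f + 1 + 2 * f = 3 * (f + 1) - 2 by omega] at h1 h2
    refine ⟨h1, quasiHomClass_vdim_eq ?_, by rw [h2]; push_cast; ring⟩
    rw [show 3 * (f + 1) - 2 = 3 * f + 1 by omega]
    push_cast; ring
  | row9 e he =>
    obtain ⟨f, rfl⟩ : ∃ f, e = f + 1 := ⟨e - 1, by omega⟩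
    obtain ⟨h1, h2⟩ := special_monoid_add_lines (K := K) (f := f) 2 1 (by norm_num) le_rfl
      (Or.inl le_rfl) (d := 4 * (f + 1)) (m₀ := 4 * (f + 1) - 2) (n := 2 * (f + 1)) (m := 3)
      (by ring) (by omega) rfl rfl
    refine ⟨h1, quasiHomClass_vdim_eq ?_, h2⟩
    rw [show 4 * (f + 1) - 2 = 4 * f + 2 by omega]
    push_cast; ring
  | row10 d e hd he =>
    obtain ⟨g, rfl⟩ : ∃ g, d = g + 1 + 2 * e := ⟨d - 1 - 2 * e, by omega⟩
    rw [show g + 1 + 2 * e - 1 = g + 2 * e by omega]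
    have hv : (quasiHomClass (g + 1 + 2 * e) (g + 2 * e) e 3).vdim =
        2 * ((g + 1 + 2 * e : ℕ) : ℤ) - 6 * e := quasiHomClass_vdim_eq (by push_cast; ring)
    -- Removing each line twice leaves (g + 1; g, 1^e). For e = 2(g + 1) this is itself a
    -- (-1)-curve, hence it joins the fixed part with N = 1 and the residual becomes 0.
    rcases eq_or_lt_of_le (show e ≤ 2 * (g + 1) by omega) with he' | he'
    · obtain ⟨h1, h2⟩ := special_monoid_add_lines (K := K) (f := g) 1 2 le_rfl (by norm_num)
        (Or.inr le_rfl) (d := g + 1 + 2 * e) (m₀ := g + 2 * e) (n := e) (m := 3)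
        (by ring) (by ring) he' rfl
      refine ⟨h1, hv, ?_⟩
      rw [h2]; push_cast; omega
    · obtain ⟨h1, h2⟩ := special_add_lines 2 le_rfl (by omega) (isGoodResidual_monoid K he')
      rw [quasiHomClass_monoid_vdim] at h2
      refine ⟨h1, hv, ?_⟩
      refine h2.trans ?_
      push_cast; ring
  | row11 d e hd he =>
    obtain ⟨a, rfl⟩ : ∃ a, d = a + 3 * e := ⟨d - 3 * e, by omega⟩
    obtain ⟨h1, h2⟩ := special_add_lines (b := a) (n := e) (c := 0) 3 (by norm_num) (by omega)
      (isGoodResidual_pencil K a e)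
    rw [add_zero, quasiHomClass_pencil_vdim] at h2
    simp only [zero_add, add_zero] at h1 h2
    exact ⟨h1, quasiHomClass_vdim_eq (by push_cast; ring), by rw [h2]; push_cast; ring⟩

end Rows

/-! ### Curves that can occur in the fixed part. -/

section Classification

open BlowupClass

namespace BlowupClass

variable {k : ℕ} {K : Type*} [Field K]

theorem IsMinusOneCurve.comp_perm {A : BlowupClass k} (h : A.IsMinusOneCurve K)
    (σ : Equiv.Perm (Fin k)) : IsMinusOneCurve K ((A.1, A.2 ∘ σ) : BlowupClass k) := by
  obtain ⟨h1, h2, δ, μ, rfl, h3⟩ := h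
  refine ⟨?_, ?_, δ, μ ∘ σ, rfl, ?_⟩
  · rw [← h1]
    simp only [inter, Function.comp_apply]
    rw [Equiv.sum_comp σ fun i => (μ i : ℤ) * μ i]
  · rw [← h2]
    simp only [genus, Function.comp_apply]
    rw [Equiv.sum_comp σ fun i => (μ i : ℤ) * (μ i - 1) / 2]
  · refine (h3.comp σ.symm.injective).mono ?_
    rintro p ⟨F, hF, hirr, hne⟩
    refine ⟨F, ⟨hF.1, fun i => ?_⟩, hirr, fun i => ?_⟩
    · simpa using hF.2 (σ i)
    · simpa using hne (σ i)

/-- The conditions on the finite set of curves in the definition of `(-1)`-special systems. -/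
structure IsSpecialSet (K : Type*) [Field K] (L : BlowupClass k) (S : Finset (BlowupClass k)) :
    Prop where
  curve : ∀ A ∈ S, A.IsMinusOneCurve K
  one_le : ∀ A ∈ S, 1 ≤ -(L.inter A)
  degree_nonneg : 0 ≤ (L.residual S).1
  vdim_nonneg : 0 ≤ (L.residual S).vdim
  nef : ∀ A : BlowupClass k, A.IsMinusOneCurve K → 0 ≤ (L.residual S).inter A

namespace IsSpecialSet

variable {L : BlowupClass k} {S : Finset (BlowupClass k)}

theorem residual_inter (L : BlowupClass k) (S : Finset (BlowupClass k)) (A : BlowupClass k) :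
    (L.residual S).inter A = L.inter A - ∑ B ∈ S, -(L.inter B) * B.inter A := by
  rw [residual, sub_eq_add_neg, inter_add_left, ← neg_one_zsmul, inter_zsmul_left, inter_sum_left]
  simp only [inter_zsmul_left]
  ring

theorem residual_fst (L : BlowupClass k) (S : Finset (BlowupClass k)) :
    (L.residual S).1 = L.1 - ∑ A ∈ S, -(L.inter A) * A.1 := by
  simp [residual, Prod.fst_sum]

theorem sum_fst_le (h : IsSpecialSet K L S) {T : Finset (BlowupClass k)}
    (hT : T ⊆ S) : ∑ A ∈ T, -(L.inter A) * A.1 ≤ L.1 := by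
  have h1 := h.degree_nonneg
  rw [residual_fst] at h1
  refine le_trans (Finset.sum_le_sum_of_subset_of_nonneg hT fun A hA _ => ?_) (by linarith)
  exact mul_nonneg (by have := h.one_le A hA; omega) (h.curve A hA).nonneg.1

variable [Infinite K] [CharZero K]

/-- Subtracting curves other than A can only lower the intersection with A, so a negative one would
stay negative on the residual. -/
theorem mem (h : IsSpecialSet K L S) {A : BlowupClass k} (hA : A.IsMinusOneCurve K)
    (hneg : L.inter A < 0) : A ∈ S := by
  by_contra hAS
  have h1 := h.nef A hA
  rw [residual_inter] at h1
  have h2 : 0 ≤ ∑ B ∈ S, -(L.inter B) * B.inter A := Finset.sum_nonneg fun B hB =>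
    mul_nonneg (by have := h.one_le B hB; omega)
      (inter_nonneg (h.curve B hB) hA fun he => hAS (he ▸ hB))
  omega

/-- Removing N_A A brings L·A up to 0, and the other curves of S can only lower it, while the
residual meets A non-negatively. -/
theorem residual_inter_eq_zero (h : IsSpecialSet K L S) {A : BlowupClass k} (hA : A ∈ S) :
    (L.residual S).inter A = 0 := by
  classical
  refine le_antisymm ?_ (h.nef A (h.curve A hA))
  rw [residual_inter, ← Finset.add_sum_erase S _ hA, (h.curve A hA).1]
  have h2 : 0 ≤ ∑ B ∈ S.erase A, -(L.inter B) * B.inter A := Finset.sum_nonneg fun B hB =>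
    mul_nonneg (by have := h.one_le B (Finset.mem_of_mem_erase hB); omega)
      (inter_nonneg (h.curve B (Finset.mem_of_mem_erase hB)) (h.curve A hA)
        (Finset.ne_of_mem_erase hB))
  linarith

theorem residual_snd (L : BlowupClass k) (S : Finset (BlowupClass k)) (i : Fin k) :
    (L.residual S).2 i = L.2 i - ∑ A ∈ S, -(L.inter A) * A.2 i := by
  simp [residual, Prod.snd_sum]

/-- The residual system has non-negative multiplicities. -/
theorem residual_snd_nonneg (h : IsSpecialSet K L S) (hL : ∀ i, 0 ≤ L.2 i) (i : Fin k) :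
    0 ≤ (L.residual S).2 i := by
  by_contra! hi
  obtain ⟨A, hAS, hAi⟩ : ∃ A ∈ S, 1 ≤ A.2 i := by
    by_contra! hcon
    rw [residual_snd, Finset.sum_eq_zero fun A hA => ?_] at hi
    · have := hL i
      omega
    · have h1 : 0 ≤ A.2 i := (h.curve A hA).nonneg.2 i
      have h2 := hcon A hA
      rw [show A.2 i = 0 by omega, mul_zero]
  have hA := h.curve A hAS
  set M := L.residual S
  -- Replacing negative multiplicities by 0 does not lower v, as m(m + 1) ≥ 0 for all integers, so
  -- M' is nonempty. It makes M'·A < 0, because M·A = 0 and A passes through p i.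
  let M' : BlowupClass k := (M.1, fun j => max (M.2 j) 0)
  have hM' : 0 ≤ M' := ⟨h.degree_nonneg, fun j => le_max_right _ _⟩
  have hv : 0 ≤ M'.vdim := by
    have hM : 0 ≤ M.vdim := h.vdim_nonneg
    refine hM.trans ?_
    rw [vdim, vdim]
    refine sub_le_sub_left (Finset.sum_le_sum fun j _ => ?_) _
    dsimp only [M']
    rcases le_total 0 (M.2 j) with hj | hj
    · rw [max_eq_left hj]
    · rw [max_eq_right hj]
      refine Int.ediv_nonneg ?_ (by norm_num)
      rcases eq_or_lt_of_le hj with hj | hj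
      · rw [hj]; norm_num
      · exact mul_nonneg_of_nonpos_of_nonpos hj.le (by omega)
  have hneg : M'.inter A < 0 := by
    have h0 : M.inter A = 0 := h.residual_inter_eq_zero hAS
    rw [← h0, inter, inter]
    refine sub_lt_sub_left (Finset.sum_lt_sum (fun j _ => ?_) ⟨i, Finset.mem_univ _, ?_⟩) _
    · exact mul_le_mul_of_nonneg_right (le_max_left _ _) (hA.nonneg.2 j)
    · exact mul_lt_mul_of_pos_right (hi.trans_le (le_max_right _ _)) (by omega)
  -- M' imposes nothing at p i, so D stays a member of M' when p i is moved to a point q off D. But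
  -- then D contains a curve of class A, which passes through q.
  obtain ⟨p, -, hupd⟩ := ((forGeneralPoints_injective k).and hA.curveAt).exists_update
  obtain ⟨D, hD, hD0⟩ : ∃ D ∈ M'.system p, D ≠ 0 := by
    refine Submodule.exists_mem_ne_zero_of_ne_bot fun hbot => ?_
    have := vdim_lt_finrank_system hM' p
    rw [hbot, finrank_bot] at this
    exact absurd this (by push_cast; linarith)
  obtain ⟨q, hq, hinj, F, hF⟩ := hupd i _ D hD0 hD.1
  have hD' : D ∈ M'.system (Function.update p i q) := by
    refine ⟨hD.1, fun j => ?_⟩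
    rcases eq_or_ne j i with rfl | hj
    · simp only [M', max_eq_right hi.le]
      exact hasMultGE_zero _ _
    · rw [Function.update_of_ne hj]
      exact hD.2 j
  have hdvd := dvd_of_inter_neg hM' hA.nonneg hinj hF hD' hneg
  have hFq : HasMultGE F _ (A.2 i).toNat := hF.1.2 i
  rw [Function.update_self] at hFq
  exact hq ((hFq.of_dvd hdvd).mono (by omega))

theorem sum_snd_le (h : IsSpecialSet K L S) (hL : ∀ i, 0 ≤ L.2 i) {T : Finset (BlowupClass k)}
    (hT : T ⊆ S) (i : Fin k) : ∑ A ∈ T, -(L.inter A) * A.2 i ≤ L.2 i := by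
  have h1 := h.residual_snd_nonneg hL i
  rw [residual_snd] at h1
  refine le_trans (Finset.sum_le_sum_of_subset_of_nonneg hT fun A hA _ => ?_) (by linarith)
  exact mul_nonneg (by have := h.one_le A hA; omega) ((h.curve A hA).nonneg.2 i)

theorem snd_le (h : IsSpecialSet K L S) (hL : ∀ i, 0 ≤ L.2 i) {A : BlowupClass k} (hA : A ∈ S)
    (i : Fin k) : -(L.inter A) * A.2 i ≤ L.2 i := by
  simpa using h.sum_snd_le hL (Finset.singleton_subset_iff.2 hA) i

theorem snd_add_le (h : IsSpecialSet K L S) (hL : ∀ i, 0 ≤ L.2 i) {A B : BlowupClass k}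
    (hA : A ∈ S) (hB : B ∈ S) (hne : A ≠ B) (i : Fin k) :
    -(L.inter A) * A.2 i + -(L.inter B) * B.2 i ≤ L.2 i := by
  classical
  have := h.sum_snd_le hL (T := {A, B}) (by
    intro x hx
    rcases Finset.mem_insert.1 hx with rfl | hx
    · exact hA
    · rw [Finset.mem_singleton.1 hx]; exact hB) i
  rwa [Finset.sum_pair hne] at this

theorem snd_add_add_le (h : IsSpecialSet K L S) (hL : ∀ i, 0 ≤ L.2 i) {A B C : BlowupClass k}
    (hA : A ∈ S) (hB : B ∈ S) (hC : C ∈ S) (hAB : A ≠ B) (hAC : A ≠ C) (hBC : B ≠ C) (i : Fin k) :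
    -(L.inter A) * A.2 i + (-(L.inter B) * B.2 i + -(L.inter C) * C.2 i) ≤ L.2 i := by
  classical
  have := h.sum_snd_le hL (T := {A, B, C}) (by
    intro x hx
    rcases Finset.mem_insert.1 hx with rfl | hx
    · exact hA
    rcases Finset.mem_insert.1 hx with rfl | hx
    · exact hB
    · rw [Finset.mem_singleton.1 hx]; exact hC) i
  rwa [Finset.sum_insert (by simp [hAB, hAC]), Finset.sum_pair hBC] at this

end IsSpecialSet

/-- The classes of `(-1)`-curves relevant for small multiplicities. -/
def IsSimpleType {n : ℕ} (A : BlowupClass (n + 1)) : Prop :=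
  (∃ i, A = lineClass n i) ∨ (∃ f : ℕ, n = 2 * (f + 1) ∧ A = quasiHomClass (f + 1) f n 1) ∨
    n = 5 ∧ A = quasiHomClass 2 0 n 1

/-- A `(-1)`-curve that is simple at the points other than `p₀`, and that has no points in common
with its images under permutations of these points, is a line, a conic, or monoidal. -/
theorem IsMinusOneCurve.isSimpleType [Infinite K] {n : ℕ} {A : BlowupClass (n + 1)}
    (hA : A.IsMinusOneCurve K) (h1 : ∀ i : Fin n, A.2 i.succ ≤ 1)
    (h2 : ∀ a b l : Fin n, (A.2 ∘ Equiv.swap a.succ b.succ) ≠ A.2 →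
      A.2 l.succ + A.2 (Equiv.swap a.succ b.succ l.succ) ≤ 1) : A.IsSimpleType := by
  have hδ : 1 ≤ A.1 := hA.one_le
  have hμ0 : 0 ≤ A.2 0 := hA.nonneg.2 0
  have hμ : A.2 0 ≤ A.1 := hA.le_degree 0
  have hnn : ∀ i : Fin n, 0 ≤ A.2 i.succ := fun i => hA.nonneg.2 i.succ
  have hself := hA.1
  have hgen : 2 * A.genus = 2 * 0 := by rw [hA.2.1]
  -- Multiplicities 0 and 1 do not contribute to the genus, so (δ - 1)(δ - 2) = μ₀(μ₀ - 1).
  rw [two_mul_genus, Fin.sum_univ_succ,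
    Finset.sum_eq_zero (s := Finset.univ) (f := fun i : Fin n => A.2 i.succ * (A.2 i.succ - 1))] at hgen
  swap
  · intro i _
    have := h1 i
    have := hnn i
    rcases (show A.2 i.succ = 0 ∨ A.2 i.succ = 1 by omega) with h | h <;> rw [h] <;> norm_num
  rw [inter, Fin.sum_univ_succ] at hself
  by_cases hone : ∃ i : Fin n, A.2 i.succ = 1
  swap
  · exfalso
    rw [Finset.sum_eq_zero (s := Finset.univ) (f := fun i : Fin n => A.2 i.succ * A.2 i.succ)] at hself
    · nlinarith
    · intro i _
      have := h1 i
      have := hnn i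
      have : A.2 i.succ ≠ 1 := fun h => hone ⟨i, h⟩
      rw [show A.2 i.succ = 0 by omega, mul_zero]
  obtain ⟨i, hi⟩ := hone
  by_cases hzero : ∃ l : Fin n, A.2 l.succ = 0
  · obtain ⟨l, hl⟩ := hzero
    -- If A passes through pᵢ and pⱼ but not pₗ, exchanging pⱼ and pₗ gives a different curve that
    -- still shares pᵢ with A.
    have honly : ∀ j, j ≠ i → A.2 j.succ = 0 := by
      intro j hj
      by_contra hj0
      have hj1 : A.2 j.succ = 1 := by have := h1 j; have := hnn j; omega
      have hil : i ≠ l := by rintro rfl; omega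
      have := h2 j l i (fun heq => by
        have := congrFun heq l.succ
        rw [Function.comp_apply, Equiv.swap_apply_right] at this
        omega)
      rw [Equiv.swap_apply_of_ne_of_ne (by simpa using hj.symm) (by simpa using hil)] at this
      omega
    refine Or.inl ⟨i, ?_⟩
    rw [Finset.sum_eq_single i (fun j _ hj => by rw [honly j hj, mul_zero]) (by simp), hi] at hself
    have hδμ : A.1 = A.2 0 := by nlinarith
    have hδ1 : A.1 = 1 := by rw [← hδμ] at hgen; nlinarith
    refine BlowupClass.ext_succ hδ1 (by rw [lineClass_snd_zero, ← hδμ, hδ1]) fun j => ?_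
    rw [lineClass_snd_succ]
    split_ifs with hj
    · rw [hj, hi]
    · exact honly j hj
  · have hall : ∀ j : Fin n, A.2 j.succ = 1 := by
      intro j
      have := h1 j
      have := hnn j
      have : A.2 j.succ ≠ 0 := fun h => hzero ⟨j, h⟩
      omega
    simp only [hall, mul_one, Finset.sum_const, Finset.card_univ, Fintype.card_fin,
      nsmul_eq_mul] at hself
    -- The genus equation factors as μ₀ = δ - 1 or μ₀ = 2 - δ, and A² = -1 gives n.
    have hprod : (A.2 0 - (A.1 - 1)) * (A.2 0 + A.1 - 2) = 0 := by linarith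
    rcases mul_eq_zero.1 hprod with h | h
    · have hm : A.2 0 = A.1 - 1 := by omega
      rw [hm] at hself
      have hn : (n : ℤ) = 2 * A.1 := by linarith
      refine Or.inr (Or.inl ⟨(A.1 - 1).toNat, by omega, BlowupClass.ext_succ ?_ ?_ fun j => ?_⟩)
      · simp only [quasiHomClass]; omega
      · rw [quasiHomClass_snd_zero]; omega
      · rw [quasiHomClass_snd_succ, hall]; rfl
    · rcases (show A.1 = 1 ∧ A.2 0 = 1 ∨ A.1 = 2 ∧ A.2 0 = 0 by omega) with ⟨ha, hb⟩ | ⟨ha, hb⟩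
      · rw [ha, hb] at hself
        have hn : n = 1 := by omega
        subst hn
        refine Or.inl ⟨0, BlowupClass.ext_succ ha hb fun j => ?_⟩
        rw [hall, Subsingleton.elim j 0, lineClass_snd_succ, if_pos rfl]
      · rw [ha, hb] at hself
        have hn : n = 5 := by omega
        subst hn
        exact Or.inr (Or.inr ⟨rfl, BlowupClass.ext_succ ha hb fun j => hall j⟩)

end BlowupClass

variable {K : Type*} [Field K] [Infinite K] [CharZero K]

theorem quasiHomClass_inter_comp_swap {d m₀ n m : ℕ} (A : BlowupClass (n + 1)) (a b : Fin n) :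
    (quasiHomClass d m₀ n m).inter (A.1, A.2 ∘ Equiv.swap a.succ b.succ) =
      (quasiHomClass d m₀ n m).inter A := by
  have hinv : ∀ i, (quasiHomClass d m₀ n m).2 (Equiv.swap a.succ b.succ i)
      = (quasiHomClass d m₀ n m).2 i := by
    intro i
    rcases eq_or_ne i a.succ with rfl | h1
    · rw [Equiv.swap_apply_left]; rfl
    rcases eq_or_ne i b.succ with rfl | h2
    · rw [Equiv.swap_apply_right]; rfl
    rw [Equiv.swap_apply_of_ne_of_ne h1 h2]
  simp only [inter, Function.comp_apply]
  congr 1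
  rw [← Equiv.sum_comp (Equiv.swap a.succ b.succ) fun i => (quasiHomClass d m₀ n m).2 i * A.2 i]
  exact Finset.sum_congr rfl fun i _ => by rw [hinv]

/-- Along S the weighted multiplicities at each pᵢ, i ≥ 1, add up to at most 3. If N_B ≥ 2, then B
is simple there and shares no point with a different permuted copy of itself, which is also in S. If
N_B = 1, the same holds provided that each point already carries a curve of weight at least 2, which
leaves room for one more. -/
theorem isSimpleType_of_mem {d m₀ n m : ℕ} (hm : m ≤ 3) {S : Finset (BlowupClass (n + 1))}
    (h : IsSpecialSet K (quasiHomClass d m₀ n m) S) {B : BlowupClass (n + 1)} (hB : B ∈ S)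
    (hcov : 2 ≤ -((quasiHomClass d m₀ n m).inter B) ∨ ∀ l : Fin n, ∃ A ∈ S,
      2 ≤ -((quasiHomClass d m₀ n m).inter A) ∧ 1 ≤ A.2 l.succ) : B.IsSimpleType := by
  set L := quasiHomClass d m₀ n m with hLdef
  have hL : ∀ i, 0 ≤ L.2 i := (quasiHomClass_nonneg d m₀ n m).2
  have hLs : ∀ l : Fin n, L.2 l.succ = m := fun l => rfl
  have hBc := h.curve B hB
  have hB1 := h.one_le B hB
  have hBn : ∀ i : Fin n, 0 ≤ B.2 i.succ := fun i => hBc.nonneg.2 i.succ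
  have hone : ∀ i : Fin n, B.2 i.succ ≤ 1 := by
    intro i
    by_cases h2 : 2 ≤ -(L.inter B)
    · have := h.snd_le hL hB i.succ
      rw [hLs] at this
      have := mul_le_mul_of_nonneg_right h2 (hBn i)
      omega
    · obtain ⟨A, hA, hA2, hAi⟩ := hcov.resolve_left h2 i
      have := h.snd_add_le hL hA hB (by rintro rfl; exact h2 hA2) i.succ
      rw [hLs] at this
      have := mul_le_mul hA2 hAi (by norm_num) (by omega)
      have := mul_le_mul_of_nonneg_right hB1 (hBn i)
      omega
  refine hBc.isSimpleType hone fun a b l hne => ?_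
  set B' : BlowupClass (n + 1) := (B.1, B.2 ∘ Equiv.swap a.succ b.succ) with hB'def
  have hBB' : B ≠ B' := fun heq => hne (congrArg Prod.snd heq).symm
  have hB'c : B'.IsMinusOneCurve K := hBc.comp_perm _
  have hLB' : L.inter B' = L.inter B := quasiHomClass_inter_comp_swap B a b
  have hB'S : B' ∈ S := h.mem hB'c (by omega)
  have hB'n : 0 ≤ B'.2 l.succ := hB'c.nonneg.2 l.succ
  change B.2 l.succ + B'.2 l.succ ≤ 1
  by_cases h2 : 2 ≤ -(L.inter B)
  · have := h.snd_add_le hL hB hB'S hBB' l.succ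
    rw [hLs, hLB', ← mul_add] at this
    have := mul_le_mul_of_nonneg_right h2 (add_nonneg (hBn l) hB'n)
    omega
  · obtain ⟨A, hA, hA2, hAl⟩ := hcov.resolve_left h2 l
    have := h.snd_add_add_le hL hA hB hB'S (by rintro rfl; exact h2 hA2)
      (by rintro rfl; rw [hLB'] at hA2; exact h2 hA2) hBB' l.succ
    rw [hLs, hLB', ← mul_add] at this
    have := mul_le_mul hA2 hAl (by norm_num) (by omega)
    have := mul_le_mul_of_nonneg_right hB1 (add_nonneg (hBn l) hB'n)
    omega

theorem residual_singleton {k : ℕ} (L A : BlowupClass k) :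
    L.residual {A} = L + L.inter A • A := by
  rw [BlowupClass.residual, Finset.sum_singleton, neg_smul, sub_neg_eq_add]

end Classification

/-! ### Determination of the numerical data. -/

section MainTheorem

open BlowupClass

variable {K : Type*} [Field K] [Infinite K] [CharZero K] {d m₀ n m : ℕ}
  {S : Finset (BlowupClass (n + 1))}

theorem quasiHomClass_inter_lineClass (d m₀ n m : ℕ) (i : Fin n) :
    (quasiHomClass d m₀ n m).inter (lineClass n i) = d - m₀ - m :=
  inter_lineClass _ _

theorem sum_lineClasses_fst (n : ℕ) (c : ℤ) : ∑ A ∈ lineClasses n, c * A.1 = c * n := by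
  rw [lineClasses, Finset.sum_map]
  simp [lineClass_fst, mul_comm]

theorem sum_lineClasses_snd_zero (n : ℕ) (c : ℤ) : ∑ A ∈ lineClasses n, c * A.2 0 = c * n := by
  rw [lineClasses, Finset.sum_map]
  simp [lineClass_snd_zero, mul_comm]

/-- By symmetry all n lines occur with the same N = m₀ + m - d, and 2 ≤ N ≤ m ≤ 3. Comparing degrees
gives d ≥ N n. Only the case m = 3, N = 2 needs the sharper bound 2d ≥ 5n. -/
theorem exists_listedSystem_of_lineClass [IsAlgClosed K] (hm : m ≤ 3)
    (h : IsSpecialSet K (quasiHomClass d m₀ n m) S) {i : Fin n} (hi : lineClass n i ∈ S)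
    (hN : 2 ≤ -((quasiHomClass d m₀ n m).inter (lineClass n i))) :
    ∃ v l : ℤ, ListedSystem d m₀ n m v l := by
  classical
  have hn : 1 ≤ n := by have := i.2; omega
  have hL : ∀ i, 0 ≤ (quasiHomClass d m₀ n m).2 i := (quasiHomClass_nonneg d m₀ n m).2
  have hc := quasiHomClass_inter_lineClass d m₀ n m
  have hmem : ∀ A ∈ lineClasses n,
      A ∈ S ∧ -((quasiHomClass d m₀ n m).inter A) = m₀ + m - d := by
    intro A hA
    obtain ⟨j, rfl⟩ := mem_lineClasses.1 hA
    refine ⟨h.mem (isMinusOneCurve_lineClass K n j) ?_, by rw [hc]; ring⟩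
    rw [hc] at hN ⊢
    omega
  have hsub : lineClasses n ⊆ S := fun A hA => (hmem A hA).1
  have hNm := h.snd_le hL hi i.succ
  rw [lineClass_snd_succ, if_pos rfl, hc, quasiHomClass_snd_succ] at hNm
  rw [hc] at hN
  have hdeg := h.sum_fst_le hsub
  rw [Finset.sum_congr rfl fun A hA => by rw [(hmem A hA).2], sum_lineClasses_fst,
    show (quasiHomClass d m₀ n m).1 = d from rfl] at hdeg
  have hdeg₀ := h.sum_snd_le hL hsub 0
  rw [Finset.sum_congr rfl fun A hA => by rw [(hmem A hA).2], sum_lineClasses_snd_zero,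
    quasiHomClass_snd_zero] at hdeg₀
  rcases (show m = 2 ∧ m₀ = d ∨ m = 3 ∧ m₀ = d ∨ m = 3 ∧ d = m₀ + 1 by omega) with
    ⟨rfl, rfl⟩ | ⟨rfl, rfl⟩ | ⟨rfl, rfl⟩
  · rw [show (m₀ : ℤ) + (2 : ℕ) - m₀ = 2 by push_cast; ring] at hdeg
    exact ⟨_, _, ListedSystem.row3 m₀ n (by omega) (by omega)⟩
  · rw [show (m₀ : ℤ) + (3 : ℕ) - m₀ = 3 by push_cast; ring] at hdeg
    exact ⟨_, _, ListedSystem.row11 m₀ n (by omega) (by omega)⟩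
  have htwo : (m₀ : ℤ) + (3 : ℕ) - (m₀ + 1 : ℕ) = 2 := by push_cast; ring
  rw [htwo] at hdeg hdeg₀ hmem
  suffices hlow : 5 * n ≤ 2 * (m₀ + 1) from
    ⟨_, _, ListedSystem.row10 (m₀ + 1) n hlow (by omega)⟩
  -- A further monoidal curve has degree n/2, so d ≥ 2n + n/2. A further conic would need N_B = 15 -
  -- 2d ≥ 1 and d ≥ 10 + 2N_B, which is impossible. Without a further curve, v ≥ 0 for the residual
  -- gives the bound.
  by_cases hex : ∃ B ∈ S, B ∉ lineClasses n
  · obtain ⟨B, hB, hBl⟩ := hex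
    have hins := h.sum_fst_le (Finset.insert_subset hB hsub)
    rw [Finset.sum_insert hBl, Finset.sum_congr rfl fun A hA => by rw [(hmem A hA).2],
      sum_lineClasses_fst, show (quasiHomClass (m₀ + 1) m₀ n 3).1 = ((m₀ + 1 : ℕ) : ℤ) from rfl] at hins
    have hB1 := h.one_le B hB
    rcases isSimpleType_of_mem hm h hB (Or.inr fun l => ⟨lineClass n l,
      (hmem _ (mem_lineClasses.2 ⟨l, rfl⟩)).1, (hmem _ (mem_lineClasses.2 ⟨l, rfl⟩)).2.ge, by
        rw [lineClass_snd_succ, if_pos rfl]⟩) with ⟨j, rfl⟩ | ⟨g, hg, rfl⟩ | ⟨hn5, rfl⟩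
    · exact absurd (mem_lineClasses.2 ⟨j, rfl⟩) hBl
    · have hfst : (quasiHomClass (g + 1) g n 1).1 = ((g + 1 : ℕ) : ℤ) := rfl
      rw [hfst] at hins
      have := mul_le_mul_of_nonneg_right hB1 (Int.natCast_nonneg (g + 1))
      omega
    · have hfst : (quasiHomClass 2 0 n 1).1 = 2 := rfl
      rw [hfst] at hins
      rw [quasiHomClass_inter_quasiHomClass] at hB1 hins
      push_cast at hB1 hins
      omega
  · have hS : S = lineClasses n := by
      refine Finset.Subset.antisymm (fun B hB => ?_) hsub
      by_contra hBl
      exact hex ⟨B, hB, hBl⟩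
    obtain ⟨g, rfl⟩ : ∃ g, m₀ = g + 2 * n := ⟨m₀ - 2 * n, by omega⟩
    have hres : (quasiHomClass (g + 2 * n + 1) (g + 2 * n) n 3).residual S
        = quasiHomClass (g + 1) g n 1 := by
      rw [BlowupClass.residual, hS, Finset.sum_congr (g := fun A => 2 • A) rfl fun A hA => by
        rw [(hmem A hA).2, two_zsmul, two_nsmul], sum_lineClasses, sub_eq_iff_eq_add]
      refine BlowupClass.ext_succ ?_ ?_ fun i => ?_
      · simp [quasiHomClass]; ring
      · simp [quasiHomClass_snd_zero]
      · simp [quasiHomClass_snd_succ]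
    have hv := h.vdim_nonneg
    rw [hres, quasiHomClass_monoid_vdim] at hv
    omega

theorem residual_eq_of_subset_singleton {k : ℕ} {L A : BlowupClass k}
    {T : Finset (BlowupClass k)} (hA : A ∈ T) (h : ∀ B ∈ T, B = A) :
    L.residual T = L + L.inter A • A := by
  rw [Finset.eq_singleton_iff_unique_mem.2 ⟨hA, h⟩, residual_singleton]

/-- Let c = d - m₀ - m be the intersection with the lines. If c < 0 the lines also lie in S, so N -
c ≤ m. The bound N f ≤ m₀ at p₀ gives c ≤ m - N. Hence |c| ≤ m - N, which leaves c = 0 for N = m and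
c ∈ {-1, 0, 1} for m = 3, N = 2. -/
theorem exists_listedSystem_of_monoid [IsAlgClosed K] (hm : m ≤ 3)
    (h : IsSpecialSet K (quasiHomClass d m₀ n m) S) {f : ℕ} (hn : n = 2 * (f + 1))
    (hA : quasiHomClass (f + 1) f n 1 ∈ S)
    (hN : 2 ≤ -((quasiHomClass d m₀ n m).inter (quasiHomClass (f + 1) f n 1))) :
    ∃ v l : ℤ, ListedSystem d m₀ n m v l := by
  have hL : ∀ i, 0 ≤ (quasiHomClass d m₀ n m).2 i := (quasiHomClass_nonneg d m₀ n m).2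
  have hc := quasiHomClass_inter_lineClass d m₀ n m
  let i : Fin n := ⟨0, by omega⟩
  have hNm := h.snd_le hL hA i.succ
  have hN₀ := h.snd_le hL hA 0
  rw [quasiHomClass_snd_succ, quasiHomClass_snd_succ] at hNm
  rw [quasiHomClass_snd_zero, quasiHomClass_snd_zero] at hN₀
  have hLA := quasiHomClass_inter_quasiHomClass d m₀ (f + 1) f n m 1
  obtain ⟨c, hcd⟩ : ∃ c : ℤ, (d : ℤ) = m₀ + m + c := ⟨d - m₀ - m, by ring⟩
  have hcL : ∀ j, (quasiHomClass d m₀ n m).inter (lineClass n j) = c := fun j => by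
    rw [hc, hcd]; ring
  have hm₀ : (m₀ : ℤ) = (m - c) * (f + 1)
      + (quasiHomClass d m₀ n m).inter (quasiHomClass (f + 1) f n 1) := by
    rw [hLA, hcd, hn]; push_cast; ring
  set N := -((quasiHomClass d m₀ n m).inter (quasiHomClass (f + 1) f n 1)) with hNdef
  rw [show (quasiHomClass d m₀ n m).inter (quasiHomClass (f + 1) f n 1) = -N by ring] at hm₀
  have hneg : c < 0 → N - c ≤ m := by
    intro hc0
    have hl := isMinusOneCurve_lineClass K n i
    have := h.snd_add_le hL hA (h.mem hl (by rw [hcL]; exact hc0)) (by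
      intro heq
      have h1 := hl.1
      rw [← heq, heq, inter_lineClass, ← heq, quasiHomClass_snd_zero, quasiHomClass_snd_succ] at h1
      simp [quasiHomClass] at h1) i.succ
    rw [quasiHomClass_snd_succ, quasiHomClass_snd_succ, lineClass_snd_succ, if_pos rfl, hcL] at this
    omega
  rcases (show m = 2 ∧ N = 2 ∨ m = 3 ∧ N = 3 ∨ m = 3 ∧ N = 2 by omega) with
    ⟨rfl, hN2⟩ | ⟨rfl, hN3⟩ | ⟨rfl, hN2⟩
  · rw [hN2] at hneg hm₀ hN₀
    have hc0 : c = 0 := by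
      rcases lt_trichotomy c 0 with h0 | h0 | h0
      · have := hneg h0; push_cast at this; omega
      · exact h0
      · push_cast at hm₀; nlinarith
    rw [hc0] at hm₀ hcd
    push_cast at hm₀ hcd
    obtain rfl : m₀ = 2 * (f + 1) - 2 := by omega
    obtain rfl : d = 2 * (f + 1) := by omega
    rw [hn]
    exact ⟨_, _, ListedSystem.row2 (f + 1) (by omega)⟩
  · rw [hN3] at hneg hm₀ hN₀
    have hc0 : c = 0 := by
      rcases lt_trichotomy c 0 with h0 | h0 | h0
      · have := hneg h0; push_cast at this; omega
      · exact h0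
      · push_cast at hm₀; nlinarith
    rw [hc0] at hm₀ hcd
    push_cast at hm₀ hcd
    obtain rfl : m₀ = 3 * (f + 1) - 3 := by omega
    obtain rfl : d = 3 * (f + 1) := by omega
    rw [hn]
    exact ⟨_, _, ListedSystem.row7 (f + 1) (by omega)⟩
  · rw [hN2] at hneg hm₀ hN₀
    have hc1 : -1 ≤ c := by
      by_contra! h0
      have := hneg (by omega)
      push_cast at this
      omega
    have hc2 : c ≤ 1 := by
      by_contra! h0
      push_cast at hm₀
      nlinarith
    rcases (show c = -1 ∨ c = 0 ∨ c = 1 by omega) with rfl | rfl | rfl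
    · push_cast at hm₀ hcd
      obtain rfl : m₀ = 4 * (f + 1) - 2 := by omega
      obtain rfl : d = 4 * (f + 1) := by omega
      rw [hn]
      exact ⟨_, _, ListedSystem.row9 (f + 1) (by omega)⟩
    · push_cast at hm₀ hcd
      obtain rfl : m₀ = 3 * (f + 1) - 2 := by omega
      obtain rfl : d = 3 * (f + 1) + 1 := by omega
      rw [hn]
      exact ⟨_, _, ListedSystem.row8 (f + 1) (by omega)⟩
    · push_cast at hm₀ hcd
      obtain rfl : m₀ = 2 * f := by omega
      obtain rfl : d = 2 * f + 4 := by omega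
      -- Lines meet the system in c = 1 > 0, and n is even, which rules out the conic. So the
      -- residual is (2; 0, 1ⁿ), with v = 5 - n ≥ 0, whence f ≤ 1.
      have hsingle : ∀ B ∈ S, B = quasiHomClass (f + 1) f n 1 := by
        intro B hB
        rcases isSimpleType_of_mem hm h hB (Or.inr fun l =>
          ⟨_, hA, hN, (quasiHomClass_snd_succ _ _ _ _ _).ge⟩) with ⟨j, rfl⟩ | ⟨g, hg, rfl⟩ | ⟨hn5, -⟩
        · have := h.one_le _ hB
          rw [hcL] at this
          omega
        · obtain rfl : g = f := by omega
          rfl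
        · omega
      have hres := residual_eq_of_subset_singleton (L := quasiHomClass (2 * f + 4) (2 * f) n 3)
        hA hsingle
      rw [show (quasiHomClass (2 * f + 4) (2 * f) n 3).inter (quasiHomClass (f + 1) f n 1) = -2 by
        omega, show quasiHomClass (2 * f + 4) (2 * f) n 3 + (-2 : ℤ) • quasiHomClass (f + 1) f n 1 =
          quasiHomClass 2 0 n 1 from BlowupClass.ext_succ
            (by simp [quasiHomClass]; ring)
            (by simp [quasiHomClass_snd_zero])
            (fun j => by simp [quasiHomClass_snd_succ])] at hres
      have hv := h.vdim_nonneg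
      rw [hres, quasiHomClass_conic_vdim] at hv
      rcases (show f = 0 ∨ f = 1 by omega) with rfl | rfl
      · rw [hn]; exact ⟨_, _, ListedSystem.row4⟩
      · rw [hn]; exact ⟨_, _, ListedSystem.row6⟩

theorem exists_listedSystem_of_conic (hm : m ≤ 3)
    (h : IsSpecialSet K (quasiHomClass d m₀ n m) S) (hn : n = 5)
    (hA : quasiHomClass 2 0 n 1 ∈ S)
    (hN : 2 ≤ -((quasiHomClass d m₀ n m).inter (quasiHomClass 2 0 n 1))) :
    ∃ v l : ℤ, ListedSystem d m₀ n m v l := by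
  classical
  have hL : ∀ i, 0 ≤ (quasiHomClass d m₀ n m).2 i := (quasiHomClass_nonneg d m₀ n m).2
  have hNm := h.snd_le hL hA (⟨0, by omega⟩ : Fin n).succ
  rw [quasiHomClass_snd_succ, quasiHomClass_snd_succ] at hNm
  push_cast at hNm
  set I := (quasiHomClass d m₀ n m).inter (quasiHomClass 2 0 n 1) with hI
  have hI' : I = 2 * d - 5 * m := by rw [hI, quasiHomClass_inter_quasiHomClass, hn]; push_cast; ring
  -- N = 5m - 2d with 2 ≤ N ≤ m ≤ 3 forces d = 2m and N = m.
  have hdI : (d : ℤ) = -I * 2 ∧ -I = m := by omega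
  -- The conic taken N times already uses up the whole degree d.
  have hsingle : ∀ B ∈ S, B = quasiHomClass 2 0 n 1 := by
    intro B hB
    by_contra hne
    have hpair := h.sum_fst_le (T := {B, quasiHomClass 2 0 n 1}) (by
      intro x hx
      rcases Finset.mem_insert.1 hx with rfl | hx
      · exact hB
      · rw [Finset.mem_singleton.1 hx]; exact hA)
    rw [Finset.sum_pair hne, ← hI, show (quasiHomClass 2 0 n 1).1 = 2 from rfl,
      show (quasiHomClass d m₀ n m).1 = d from rfl] at hpair
    have := mul_le_mul (h.one_le B hB) (h.curve B hB).one_le (by norm_num)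
      (by have := h.one_le B hB; omega)
    omega
  have hres := residual_eq_of_subset_singleton (L := quasiHomClass d m₀ n m) hA hsingle
  rw [← hI, show quasiHomClass d m₀ n m + I • quasiHomClass 2 0 n 1 = quasiHomClass 0 m₀ n 0 from
    BlowupClass.ext_succ (by simp [quasiHomClass]; omega) (by simp [quasiHomClass_snd_zero])
      (fun j => by simp [quasiHomClass_snd_succ]; omega)] at hres
  have hv := h.vdim_nonneg
  rw [hres, quasiHomClass_vdim] at hv
  -- The residual has degree 0, so any positive multiplicity at p₀ would make its virtual dimension
  -- negative.
  have hm₀ : m₀ = 0 := by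
    by_contra hne
    have h1 : (1 : ℤ) ≤ m₀ := by exact_mod_cast Nat.one_le_iff_ne_zero.2 hne
    have h2 : 1 ≤ (m₀ : ℤ) * (m₀ + 1) / 2 := by
      rw [Int.le_ediv_iff_mul_le (by norm_num)]
      nlinarith
    push_cast at hv
    norm_num at hv
    omega
  subst hm₀ hn
  rcases (show m = 2 ∧ d = 4 ∨ m = 3 ∧ d = 6 by omega) with ⟨rfl, rfl⟩ | ⟨rfl, rfl⟩
  · exact ⟨_, _, ListedSystem.row1⟩
  · exact ⟨_, _, ListedSystem.row5⟩

theorem exists_listedSystem [IsAlgClosed K] (hm : m ≤ 3)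
    (h : (quasiHomClass d m₀ n m).IsMinusOneSpecial K) :
    ∃ v l : ℤ, ListedSystem d m₀ n m v l := by
  obtain ⟨S, hS, ⟨A, hA, hA2⟩, hdeg, hv, hnef⟩ := h
  have h : IsSpecialSet K (quasiHomClass d m₀ n m) S :=
    ⟨fun A hA => (hS A hA).1, fun A hA => (hS A hA).2, hdeg, hv, hnef⟩
  rcases isSimpleType_of_mem hm h hA (Or.inl hA2) with ⟨i, rfl⟩ | ⟨f, hn, rfl⟩ | ⟨hn, rfl⟩
  · exact exists_listedSystem_of_lineClass hm h hA hA2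
  · exact exists_listedSystem_of_monoid hm h hn hA hA2
  · exact exists_listedSystem_of_conic hm h hn hA hA2

end MainTheorem

theorem mainTheorem8 (K : Type*) [Field K] [IsAlgClosed K] [CharZero K] :
    (∀ d m₀ n m : ℕ, m ≤ 3 →
      ((quasiHomClass d m₀ n m).IsMinusOneSpecial K ↔
        ∃ v l : ℤ, ListedSystem d m₀ n m v l)) ∧
    (∀ (d m₀ n m : ℕ) (v l : ℤ), ListedSystem d m₀ n m v l →
      (quasiHomClass d m₀ n m).vdim = v ∧
        genericDim K d (quasiHomMult m₀ n m) = l) :=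
  ⟨fun _ _ _ _ hm => ⟨exists_listedSystem hm, fun ⟨_, _, h⟩ => (h.special_and_dim K).1⟩,
    fun _ _ _ _ _ _ h => (h.special_and_dim K).2⟩
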